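/- Let $\mathcal A$ be a finite-dimensional commutative associative unital $\mathbb R$-algebra with a linear form $\mathrm{tr}:\mathcal A\to\mathbb R$ such that $\langle a,b\rangle=\mathrm{tr}(ab)$ is nondegenerate (a Frobenius algebra), let $e_1,\dots,e_n$ be a basis of $\mathcal A$ and let $m\ge 1$. Put $$\mathcal L=\partial^m+V_{m-1}\partial^{m-1}+V_{m-2}\partial^{m-2}+\cdots,\qquad V_i=\sum_{q=1}^n v_{[i]q}e_q\quad(i\le m-1),$$ where the $v_{[i]q}$ are independent fields. Let $\mathfrak D$ be the ring of real differential polynomials in the $v_{[i]q}$, with total derivative $\partial=d/dx$; pseudo-differential operators have coefficients in $\mathcal A\otimes\mathfrak D$, to which $\mathrm{tr}$ is extended coefficientwise. A functional $\tilde f=\int f\,dx$ is the class of $f\in\mathfrak D$ modulo $\partial\mathfrak D$. Its gradient is $$\frac{\delta f}{\delta\mathcal L}=\sum_{i\le m-1}\partial^{-i-1}\frac{\delta f}{\delta V_i},\qquad \mathrm{tr}\Big(\frac{\delta f}{\delta V_i}\,e_q\Big)=\frac{\delta f}{\delta v_{[i]q}}=\sum_{j\ge0}(-\partial)^j\frac{\partial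 f}{\partial v_{[i]q}^{(j)}}\quad(1\le q\le n).$$ For an operator $P=\sum_iP_i\partial^i$ let $P_+=\sum_{i\ge0}P_i\partial^i$, $P_-=P-P_+$ and $\mathrm{res}\,P=P_{-1}$. Define $$H^{m(0)}(X)=(\mathcal LX)_+\mathcal L-\mathcal L(X\mathcal L)_+,\qquad H^{m(\infty)}(X)=[\mathcal L_-,X_+]_--[\mathcal L_+,X_-]_+ .$$ **Theorem.** (a) $H^{m(0)}$ and $H^{m(\infty)}$ are compatible Hamiltonian operators: for all $\alpha,\beta\in\mathbb R$ the operator $H=\alpha H^{m(0)}+\beta H^{m(\infty)}$ sends gradients of functionals to operators of order at most $m-1$, and $\{\tilde f,\tilde g\}=\mathrm{tr}\int\mathrm{res}\big(H(\tfrac{\delta f}{\delta\mathcal L})\tfrac{\delta g}{\delta\mathcal L}\big)dx$ is a Poisson bracket on functionals (bilinear, skew-symmetric, satisfying the Jacobi identity). The brackets of $H^{m(0)}$ and $H^{m(\infty)}$ preserve the set of functionals $\int\mathrm{tr}\,F(V)\,dx$, where $F$ is an $\mathcal A$-valued differential polynomial in the $V_i$. (b) There is a unique operator $L=\partial+U_0+U_1\partial^{-1}+\cdots$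 with $L^m=\mathcal L$. For every $r\ge1$ the functionals $$\tilde h_r=\frac mr\,\mathrm{tr}\int\mathrm{res}\,L^r\,dx,\qquad \tilde g_r=-\frac m{r+m}\,\mathrm{tr}\int\mathrm{res}\,L^{m+r}\,dx$$ are of the form $\int\mathrm{tr}\,F(V)\,dx$, and, with $B_r=(L^r)_+$, $$[B_r,\mathcal L]=H^{m(0)}\Big(\frac{\delta h_r}{\delta\mathcal L}\Big)=H^{m(\infty)}\Big(\frac{\delta g_r}{\delta\mathcal L}\Big).$$ (c) Consequently the $\mathcal A$-KP hierarchy is bi-Hamiltonian: for $L=\partial+U_0+U_1\partial^{-1}+\cdots$ whose coefficients are $\mathcal A$-valued functions (more generally, elements of any commutative $\mathcal A$-algebra with commuting $\mathcal A$-linear derivations $\partial$ and $\partial_{t_r}$), $\mathcal L=L^m$ and $r\ge1$, the equation $\partial_{t_r}L=[B_r,L]$ is equivalent to each of $$\partial_{t_r}\mathcal L=H^{m(0)}\Big(\frac{\delta h_r}{\delta\mathcal L}\Big),\qquad \partial_{t_r}\mathcal L=H^{m(\infty)}\Big(\frac{\delta g_r}{\delta\mathcal L}\Big).$$ -/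

import Mathlib

noncomputable section

namespace AKP

open MvPolynomial

universe u v w

/-! ### Frobenius algebras -/

/-- A trace form on a commutative real algebra `A`: a linear form `tr` for which the symmetric
bilinear form `⟨a, b⟩ = tr (a * b)` is nondegenerate.  A finite-dimensional commutative unital
real algebra with such a form is a Frobenius algebra. -/
structure TraceForm (A : Type u) [CommRing A] [Algebra ℝ A] where
  tr : A →ₗ[ℝ] ℝ
  nondegenerate :
    ((LinearMap.mul ℝ A).compr₂ tr : LinearMap.BilinForm ℝ A).Nondegenerate

/-- The inner product `⟨a, b⟩ = tr (a * b)`. -/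
def TraceForm.form {A : Type u} [CommRing A] [Algebra ℝ A] (ω : TraceForm A) :
    LinearMap.BilinForm ℝ A :=
  (LinearMap.mul ℝ A).compr₂ ω.tr

/-- The basis dual to `e` for the inner product: `tr (dual q * e p)` is `1` if `p = q`, else `0`. -/
def TraceForm.dual {A : Type u} [CommRing A] [Algebra ℝ A] (ω : TraceForm A) {n : ℕ}
    (e : Module.Basis (Fin n) ℝ A) : Module.Basis (Fin n) ℝ A :=
  LinearMap.BilinForm.dualBasis ω.form ω.nondegenerate e

/-! ### Formal pseudo-differential operators -/

section PsiDO

variable {k : Type u} [CommRing k] {R : Type v} [CommRing R] [Algebra k R]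
variable {k' : Type u} [CommRing k'] {R' : Type w} [CommRing R'] [Algebra k' R']

/-- Coefficient sequences indexed by `ℤ` that vanish above some order. -/
def boundedAbove (R : Type v) [CommRing R] : AddSubgroup (ℤ → R) where
  carrier := {a | ∃ N : ℤ, ∀ i, N < i → a i = 0}
  zero_mem' := ⟨0, fun _ _ => rfl⟩
  add_mem' := by
    rintro a b ⟨N, hN⟩ ⟨M, hM⟩
    refine ⟨max N M, fun i hi => ?_⟩
    simp [hN i (lt_of_le_of_lt (le_max_left _ _) hi), hM i (lt_of_le_of_lt (le_max_right _ _) hi)]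
  neg_mem' := by
    rintro a ⟨N, hN⟩
    exact ⟨N, fun i hi => by simp [hN i hi]⟩

/-- Formal pseudo-differential operators `∑_{i ≤ N} a_i ∂^i`, with coefficients in a commutative
ring `R` and with `∂` acting on `R` as the derivation `d`. -/
def PsiDO (_d : Derivation k R R) : Type v := boundedAbove R

namespace PsiDO

variable {d : Derivation k R R} {d' : Derivation k' R' R'}

instance : AddCommGroup (PsiDO d) := inferInstanceAs (AddCommGroup (boundedAbove R))

/-- The coefficient of `∂^i` (coefficients written on the left). -/
def coeff (P : PsiDO d) (i : ℤ) : R := P.1 i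

@[ext] theorem ext {P Q : PsiDO d} (h : ∀ i, P.coeff i = Q.coeff i) : P = Q :=
  Subtype.ext (funext h)

theorem exists_bound (P : PsiDO d) : ∃ N : ℤ, ∀ i, N < i → P.coeff i = 0 := P.2

/-- The coefficients of the composition, from `∂^i b = ∑_l (i choose l) b^{(l)} ∂^{i-l}` for
`i ∈ ℤ`.  The sum has finitely many nonzero terms, see `finite_mulTerm`. -/
def mulTerm (P Q : PsiDO d) (s : ℤ) (p : ℤ × ℕ) : R :=
  Ring.choose p.1 p.2 • (P.coeff p.1 * (d^[p.2] (Q.coeff (s - p.1 + p.2))))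

theorem finite_mulTerm (P Q : PsiDO d) (s : ℤ) : (Function.support (mulTerm P Q s)).Finite := by
  obtain ⟨N, hN⟩ := P.exists_bound
  obtain ⟨M, hM⟩ := Q.exists_bound
  refine Set.Finite.subset
    ((Set.finite_Icc (s - M) N).prod (Set.finite_Iic (M - s + N).toNat)) ?_
  rintro ⟨i, l⟩ h
  have h1 : i ≤ N := by
    by_contra hi
    exact h (by simp [mulTerm, hN i (not_le.1 hi)])
  have h2 : s - i + l ≤ M := by
    by_contra hi
    exact h (by simp [mulTerm, hM _ (not_le.1 hi)])
  simp only [Set.mem_prod, Set.mem_Icc, Set.mem_Iic]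
  omega

/-- Composition of pseudo-differential operators. -/
instance : Mul (PsiDO d) where
  mul P Q := ⟨fun s => ∑ᶠ p : ℤ × ℕ, mulTerm P Q s p, by
    obtain ⟨N, hN⟩ := P.exists_bound
    obtain ⟨M, hM⟩ := Q.exists_bound
    refine ⟨N + M, fun s hs => finsum_eq_zero_of_forall_eq_zero ?_⟩
    rintro ⟨i, l⟩
    by_cases hi : N < i
    · simp [mulTerm, hN i hi]
    · have : M < s - i + l := by omega
      simp [mulTerm, hM _ this]⟩

/-- The operator `a ∂^i`. -/
def monomial (a : R) (i : ℤ) : PsiDO d :=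
  ⟨fun j => if j = i then a else 0, i, fun _ hj => if_neg (ne_of_gt hj)⟩

instance : One (PsiDO d) := ⟨monomial 1 0⟩

/-- `P ^ r = P ∘ ⋯ ∘ P` (`r` factors). -/
instance : Pow (PsiDO d) ℕ := ⟨fun P r => npowRec r P⟩

/-- `[P, Q] = P ∘ Q - Q ∘ P`. -/
def comm (P Q : PsiDO d) : PsiDO d := P * Q - Q * P

/-- The pure differential part `P_+`. -/
def plus (P : PsiDO d) : PsiDO d :=
  ⟨fun i => if 0 ≤ i then P.coeff i else 0, by
    obtain ⟨N, hN⟩ := P.exists_bound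
    exact ⟨N, fun i hi => by simp [hN i hi]⟩⟩

/-- The integral part `P_- = P - P_+`. -/
def minus (P : PsiDO d) : PsiDO d := P - P.plus

/-- The residue, the coefficient of `∂^{-1}`. -/
def res (P : PsiDO d) : R := P.coeff (-1)

/-- `P = ∂^N + (terms of lower order)`. -/
def IsMonic (P : PsiDO d) (N : ℤ) : Prop := P.coeff N = 1 ∧ ∀ i, N < i → P.coeff i = 0

/-- Apply an additive map (a time derivative, a substitution) to all coefficients. -/
def mapCoeff (φ : R →+ R') (P : PsiDO d) : PsiDO d' :=
  ⟨fun i => φ (P.coeff i), by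
    obtain ⟨N, hN⟩ := P.exists_bound
    exact ⟨N, fun i hi => by simp [hN i hi]⟩⟩

/-- `H^{(0)}(X) = (ℒ X)_+ ℒ - ℒ (X ℒ)_+`, the Adler map. -/
def H0 (ℒ X : PsiDO d) : PsiDO d := (ℒ * X).plus * ℒ - ℒ * (X * ℒ).plus

/-- `H^{(∞)}(X) = [ℒ_-, X_+]_- - [ℒ_+, X_-]_+`. -/
def Hinf (ℒ X : PsiDO d) : PsiDO d :=
  (comm ℒ.minus X.plus).minus - (comm ℒ.plus X.minus).plus

end PsiDO

end PsiDO

/-! ### Differential polynomials -/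

/-- The jet variables `v_{[i]q}^{(j)}`: a triple `(i, q, j)` with `i ≤ m - 1` an integer. -/
abbrev JetVar (m n : ℕ) : Type := Set.Iio (m : ℤ) × Fin n × ℕ

/-- Differential polynomials in the `v_{[i]q}` with constant coefficients in `k`.  For `k = ℝ`
these are the scalar ones, for `k = A` the `A`-valued ones. -/
abbrev DiffPoly (m n : ℕ) (k : Type u) [CommRing k] : Type u := MvPolynomial (JetVar m n) k

/-- The total derivative `∂ = d/dx`, with `∂ v^{(j)} = v^{(j+1)}`. -/
def totalD (m n : ℕ) (k : Type u) [CommRing k] :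
    Derivation k (DiffPoly m n k) (DiffPoly m n k) :=
  mkDerivation k (fun p => X (p.1, p.2.1, p.2.2 + 1))

section Euler

variable {m n : ℕ}

theorem finite_support_pderiv (i : Set.Iio (m : ℤ)) (q : Fin n) (f : DiffPoly m n ℝ) :
    ((fun j : ℕ => pderiv (i, q, j) f).support).Finite := by
  refine Set.Finite.subset (Set.Finite.preimage (f := fun j : ℕ => ((i, q, j) : JetVar m n))
    (by intro a _ b _ h; simpa using h) (Finset.finite_toSet f.vars)) ?_
  intro j hj
  by_contra h
  exact hj (pderiv_eq_zero_of_notMem_vars h)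

/-- `(-∂)^j` as a linear map. -/
def negDPow (m n j : ℕ) : DiffPoly m n ℝ →ₗ[ℝ] DiffPoly m n ℝ :=
  (-(totalD m n ℝ : DiffPoly m n ℝ →ₗ[ℝ] DiffPoly m n ℝ)) ^ j

theorem finite_support_euler (i : Set.Iio (m : ℤ)) (q : Fin n) (f : DiffPoly m n ℝ) :
    ((fun j : ℕ => negDPow m n j (pderiv (i, q, j) f)).support).Finite := by
  refine (finite_support_pderiv i q f).subset fun j hj h => hj ?_
  have h' : pderiv (i, q, j) f = 0 := h
  simp [h']

/-- The Euler operator `f ↦ δf/δv_{[i]q} = ∑_j (-∂)^j (∂f/∂v_{[i]q}^{(j)})` on densities. -/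
def euler (i : Set.Iio (m : ℤ)) (q : Fin n) : DiffPoly m n ℝ →ₗ[ℝ] DiffPoly m n ℝ where
  toFun f := ∑ᶠ j : ℕ, negDPow m n j (pderiv (i, q, j) f)
  map_add' f g := by
    rw [← finsum_add_distrib (finite_support_euler i q f) (finite_support_euler i q g)]
    simp
  map_smul' c f := by
    simp only [Derivation.map_smul, LinearMap.map_smul, RingHom.id_apply]
    rw [smul_finsum]

theorem pderiv_totalD (i : Set.Iio (m : ℤ)) (q : Fin n) (j : ℕ) (f : DiffPoly m n ℝ) :
    pderiv (i, q, j) (totalD m n ℝ f) = totalD m n ℝ (pderiv (i, q, j) f) +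
      (if j = 0 then 0 else pderiv (i, q, j - 1) f) := by
  have h : ⁅(pderiv (i, q, j) : Derivation ℝ (DiffPoly m n ℝ) (DiffPoly m n ℝ)), totalD m n ℝ⁆
      = if j = 0 then 0 else pderiv (i, q, j - 1) := by
    apply MvPolynomial.derivation_ext
    rintro ⟨a, b, c⟩
    have h0 : totalD m n ℝ (pderiv (i, q, j) (X (a, b, c) : DiffPoly m n ℝ)) = 0 := by
      classical
      rw [pderiv_X, Pi.single_apply]
      split_ifs <;> simp
    rw [Derivation.commutator_apply, h0, sub_zero, totalD, mkDerivation_X]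
    rcases j with _ | j
    · rw [pderiv_X_of_ne (by simp)]; simp
    · classical
      simp only [Nat.succ_ne_zero, if_false, Nat.add_sub_cancel]
      rw [pderiv_X, pderiv_X, Pi.single_apply, Pi.single_apply]
      simp
  have h2 := congrArg (fun D : Derivation ℝ (DiffPoly m n ℝ) (DiffPoly m n ℝ) => D f) h
  simp only [Derivation.commutator_apply] at h2
  rw [sub_eq_iff_eq_add'] at h2
  rw [h2]
  split_ifs <;> rfl

/-- Variational derivatives of total derivatives vanish. -/
theorem euler_totalD (i : Set.Iio (m : ℤ)) (q : Fin n) (f : DiffPoly m n ℝ) :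
    euler i q (totalD m n ℝ f) = 0 := by
  obtain ⟨N, hN⟩ := (finite_support_pderiv i q f).bddAbove
  have hz : ∀ j, N < j → pderiv (i, q, j) f = 0 := by
    intro j hj
    by_contra h
    exact absurd (hN (show j ∈ Function.support _ from h)) (not_le.2 hj)
  have hsucc : ∀ (j : ℕ) (g : DiffPoly m n ℝ),
      negDPow m n (j + 1) g = - negDPow m n j (totalD m n ℝ g) := by
    intro j g
    simp [negDPow, pow_succ]
  have key : ∀ M : ℕ, ∑ j ∈ Finset.range (M + 1),
      negDPow m n j (pderiv (i, q, j) (totalD m n ℝ f))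
        = negDPow m n M (totalD m n ℝ (pderiv (i, q, M) f)) := by
    intro M
    induction M with
    | zero => simp [pderiv_totalD]
    | succ M ih =>
      rw [Finset.sum_range_succ, ih, pderiv_totalD]
      simp [hsucc]
  change ∑ᶠ j : ℕ, negDPow m n j (pderiv (i, q, j) (totalD m n ℝ f)) = 0
  rw [finsum_eq_sum_of_support_subset (s := Finset.range (N + 2)), key, hz (N + 1) (by omega)]
  · simp
  · intro j hj
    by_contra h
    have hj' : N + 2 ≤ j := by simpa using h
    refine hj ?_
    have h1 : ¬ j = 0 := by omega
    simp [pderiv_totalD, hz j (by omega), hz (j - 1) (by omega), h1]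

end Euler

/-! ### Functionals and variational derivatives -/

/-- The densities that are total derivatives. -/
def exact (m n : ℕ) : Submodule ℝ (DiffPoly m n ℝ) :=
  LinearMap.range (totalD m n ℝ : DiffPoly m n ℝ →ₗ[ℝ] DiffPoly m n ℝ)

/-- Functionals `∫ f dx`: densities modulo total derivatives. -/
abbrev Functional (m n : ℕ) : Type := DiffPoly m n ℝ ⧸ exact m n

/-- `f ↦ ∫ f dx`. -/
def integral {m n : ℕ} (f : DiffPoly m n ℝ) : Functional m n := (exact m n).mkQ f

/-- The variational derivative `δf/δv_{[i]q}` of a functional. -/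
def varDeriv {m n : ℕ} (i : Set.Iio (m : ℤ)) (q : Fin n) :
    Functional m n →ₗ[ℝ] DiffPoly m n ℝ :=
  (exact m n).liftQ (euler i q) (by
    rintro _ ⟨f, rfl⟩
    exact euler_totalD i q f)

section Frobenius

variable {A : Type u} [CommRing A] [Algebra ℝ A] {n : ℕ}

/-- The trace form applied to the coefficients of an `A`-valued differential polynomial. -/
def trPoly (ω : TraceForm A) {m : ℕ} (F : DiffPoly m n A) : DiffPoly m n ℝ :=
  ∑ s ∈ F.support, MvPolynomial.monomial s (ω.tr (F.coeff s))

/-- The `A`-valued variational derivative `δf/δV_i = ∑_q (δf/δv_{[i]q}) e^q` with `e^q` the dual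
basis; it is the element with `tr ((δf/δV_i) e_q) = δf/δv_{[i]q}` for all `q`. -/
def gradV (ω : TraceForm A) (e : Module.Basis (Fin n) ℝ A) {m : ℕ} (f : Functional m n)
    (i : Set.Iio (m : ℤ)) : DiffPoly m n A :=
  ∑ q, C (ω.dual e q) * map (algebraMap ℝ A) (varDeriv i q f)

/-- `δf/δℒ = ∑_{i ≤ m-1} ∂^{-i-1} ∘ δf/δV_i` (a finite sum, since a differential polynomial
involves finitely many `V_i`). -/
def grad (ω : TraceForm A) (e : Module.Basis (Fin n) ℝ A) {m : ℕ} (f : Functional m n) :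
    PsiDO (totalD m n A) :=
  ∑ᶠ i : Set.Iio (m : ℤ),
    (PsiDO.monomial 1 (-(i : ℤ) - 1) : PsiDO (totalD m n A)) * PsiDO.monomial (gradV ω e f i) 0

/-- The jet `V_i^{(j)} = ∑_q v_{[i]q}^{(j)} e_q`. -/
def jetV (e : Module.Basis (Fin n) ℝ A) {m : ℕ} (i : Set.Iio (m : ℤ)) (j : ℕ) :
    DiffPoly m n A :=
  ∑ q, C (e q) * X (i, q, j)

/-- The universal operator `ℒ = ∂^m + V_{m-1} ∂^{m-1} + V_{m-2} ∂^{m-2} + ⋯`. -/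
def genericL (e : Module.Basis (Fin n) ℝ A) (m : ℕ) : PsiDO (totalD m n A) :=
  ⟨fun i => if h : i < (m : ℤ) then jetV e ⟨i, h⟩ 0 else if i = m then 1 else 0,
    m, fun i hi => by simp [not_lt.2 hi.le, hi.ne']⟩

/-- Functionals of the form `∫ tr F(V) dx` with `F` an `A`-valued differential polynomial in the
fields `V_i`. -/
def trFunctionals (ω : TraceForm A) (e : Module.Basis (Fin n) ℝ A) (m : ℕ) :
    Set (Functional m n) :=
  {f | ∃ F ∈ Algebra.adjoin A (Set.range fun p : Set.Iio (m : ℤ) × ℕ => jetV e p.1 p.2),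
    f = integral (trPoly ω F)}

/-- The bracket `{f, g} = tr ∫ res (H(δf/δℒ) ∘ δg/δℒ) dx` of an operator `H`. -/
def bracket (ω : TraceForm A) (e : Module.Basis (Fin n) ℝ A) {m : ℕ}
    (H : PsiDO (totalD m n A) → PsiDO (totalD m n A)) (f g : Functional m n) : Functional m n :=
  integral (trPoly ω (H (grad ω e f) * grad ω e g).res)

/-- A Hamiltonian operator: it sends differentials of functionals to vector fields
`∑_{i ≤ m-1} a_i ∂^i`, and its bracket is a Poisson bracket on functionals, that is, bilinear,
skew-symmetric and subject to the Jacobi identity. -/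
structure IsHamiltonian (ω : TraceForm A) (e : Module.Basis (Fin n) ℝ A) {m : ℕ}
    (H : PsiDO (totalD m n A) → PsiDO (totalD m n A)) : Prop where
  vectorField : ∀ f i, (m : ℤ) ≤ i → (H (grad ω e f)).coeff i = 0
  add_left : ∀ f₁ f₂ g,
    bracket ω e H (f₁ + f₂) g = bracket ω e H f₁ g + bracket ω e H f₂ g
  smul_left : ∀ (c : ℝ) (f g), bracket ω e H (c • f) g = c • bracket ω e H f g
  skew : ∀ f g, bracket ω e H f g = - bracket ω e H g f
  jacobi : ∀ f g h, bracket ω e H f (bracket ω e H g h) + bracket ω e H g (bracket ω e H h f)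
    + bracket ω e H h (bracket ω e H f g) = 0

/-- The linear combination `α H^{(0)} + β H^{(∞)}` of the two operators at `ℒ`. -/
def pencil (e : Module.Basis (Fin n) ℝ A) (m : ℕ) (α β : ℝ) (Y : PsiDO (totalD m n A)) :
    PsiDO (totalD m n A) :=
  PsiDO.monomial (C (algebraMap ℝ A α)) 0 * PsiDO.H0 (genericL e m) Y
    + PsiDO.monomial (C (algebraMap ℝ A β)) 0 * PsiDO.Hinf (genericL e m) Y

/-- The Hamiltonian `h_r = (m/r) tr ∫ res L^r dx`. -/
def hamH (ω : TraceForm A) {m : ℕ} (L : PsiDO (totalD m n A)) (r : ℕ) : Functional m n :=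
  ((m : ℝ) / r) • integral (trPoly ω (L ^ r).res)

/-- The Hamiltonian `g_r = -(m/(r+m)) tr ∫ res L^{m+r} dx`. -/
def hamG (ω : TraceForm A) {m : ℕ} (L : PsiDO (totalD m n A)) (r : ℕ) : Functional m n :=
  (-((m : ℝ) / (r + m))) • integral (trPoly ω (L ^ (m + r)).res)

/-- Substitution of `w i q` and its derivatives for `v_{[i]q}` and its derivatives. -/
def subst {m : ℕ} {R : Type v} [CommRing R] [Algebra A R] (d : Derivation A R R)
    (w : Set.Iio (m : ℤ) → Fin n → R) : DiffPoly m n A →+* R :=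
  (aeval fun p : JetVar m n => d^[p.2.2] (w p.1 p.2.1) : DiffPoly m n A →ₐ[A] R)

/-- An operator with differential-polynomial coefficients, evaluated at the fields `w`. -/
def evalOp {m : ℕ} {R : Type v} [CommRing R] [Algebra A R] (d : Derivation A R R)
    (w : Set.Iio (m : ℤ) → Fin n → R) (P : PsiDO (totalD m n A)) : PsiDO d :=
  P.mapCoeff (subst d w : DiffPoly m n A →+* R).toAddMonoidHom

/-- The time derivative of an operator, for a derivation `D` of the coefficient ring. -/
def timeDeriv {R : Type v} [CommRing R] [Algebra A R] {d : Derivation A R R}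
    (D : Derivation A R R) (P : PsiDO d) : PsiDO d :=
  P.mapCoeff (D : R →ₗ[A] R).toAddMonoidHom

/-- The `r`-th equation `∂L/∂t_r = [B_r, L]` of the hierarchy, `B_r = (L^r)_+`, with `D = ∂/∂t_r`. -/
def IsKPFlow {R : Type v} [CommRing R] [Algebra A R] {d : Derivation A R R}
    (D : Derivation A R R) (L : PsiDO d) (r : ℕ) : Prop :=
  timeDeriv D L = PsiDO.comm (L ^ r).plus L

end Frobenius

end AKP

end

/-! Because the coefficients commute, the residue of a commutator is a total derivative, so `P ↦ tr
∫ res P dx` (`trace`) is a trace on the ring of pseudo-differential operators. The operators `P_+`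
and the operators `P_-` form two complementary subrings on each of which this trace pairing
vanishes. These properties, axiomatised in `IsotropicSplitting`, already make the Adler map skew and
its Schouten bracket zero (`adler_skew`, `adler_schouten`). The gradient represents the first
variation (`trace_mul_grad`) and the second variation is symmetric (`trace_second_variation`), so
the terms of the Jacobi identity that differentiate gradients cancel, and only the Schouten bracket
remains (`adler_jacobi`).

Compatibility comes from shifting `ℒ` by a real constant `c`. The argument applies verbatim to `ℒ +
c`, whose Adler map is `H^{(0)} - c H^{(∞)}` (`H0_add_central`). The Jacobi expression is quadratic
in the bracket, so three values of `c` give the identity for the whole pencil.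

The root `L` is built coefficient by coefficient (`exists_solution`), since `m` is invertible. Its
coefficients stay in the ring `jetRing` of differential polynomials in the `V_i`, which is why `h_r`
and `g_r` have the form `∫ tr F(V) dx`. Cyclicity of the trace shows that `(m/k) tr ∫ res L^k dx`
has gradient `L^{k-m}`, up to terms of order below `-m` (`ordLE_grad_trace_pow`), and both operators
kill such terms. Inserting `L^{r-m}` into `H^{(0)}` and `-L^r` into `H^{(∞)}` gives `[B_r, ℒ]` in
both cases.

For the hierarchy, `∂_t - [B_r, ·]` is a derivation, so it kills a monic first-order operator
exactly when it kills its `m`-th power (`isKPFlow_iff`). The universal identities pass to concrete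
fields along the evaluation homomorphism `evalHom`, which takes `L` to the given operator by
uniqueness of roots. -/

noncomputable section

namespace AKP

open MvPolynomial

universe u v w

/-! ### Leibniz rule and binomial identities -/

section Leibniz

open Finset

/-- The general Leibniz rule. -/
theorem iterate_derivation_mul {k : Type u} [CommRing k] {R : Type v} [CommRing R] [Algebra k R]
    (d : Derivation k R R) (n : ℕ) (a b : R) :
    d^[n] (a * b) = ∑ p ∈ antidiagonal n, n.choose p.1 • (d^[p.1] a * d^[p.2] b) := by
  induction n with
  | zero => simp
  | succ n ih =>
    rw [sum_antidiagonal_choose_succ_nsmul (M := R) (fun i j => d^[i] a * d^[j] b) n]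
    simp only [Function.iterate_succ_apply', ih, map_sum, map_nsmul, Derivation.leibniz, smul_add,
      sum_add_distrib, smul_eq_mul]
    congr 1
    refine sum_congr rfl fun ⟨i, j⟩ hij => ?_
    rw [n.choose_symm_of_eq_add (HasAntidiagonal.mem_antidiagonal.1 hij).symm, mul_comm]

theorem sum_antidiagonal_assoc {M : Type*} [AddCommMonoid M] (f : ℕ → ℕ → ℕ → M) (t : ℕ) :
    ∑ p ∈ antidiagonal t, ∑ s ∈ antidiagonal p.2, f p.1 s.1 s.2
      = ∑ p ∈ antidiagonal t, ∑ s ∈ antidiagonal p.1, f s.1 s.2 p.2 := by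
  rw [sum_sigma', sum_sigma']
  refine sum_nbij' (fun x => ⟨(x.1.1 + x.2.1, x.2.2), (x.1.1, x.2.1)⟩)
    (fun x => ⟨(x.2.1, x.2.2 + x.1.2), (x.2.2, x.1.2)⟩) ?_ ?_ ?_ ?_ ?_
  · rintro ⟨⟨a, b⟩, ⟨c, e⟩⟩ h
    simp only [mem_sigma, HasAntidiagonal.mem_antidiagonal] at h ⊢
    obtain ⟨rfl, rfl⟩ := h
    simp [add_assoc]
  · rintro ⟨⟨a, b⟩, ⟨c, e⟩⟩ h
    simp only [mem_sigma, HasAntidiagonal.mem_antidiagonal] at h ⊢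
    obtain ⟨rfl, rfl⟩ := h
    simp [add_assoc]
  · rintro ⟨⟨a, b⟩, ⟨c, e⟩⟩ h
    simp only [mem_sigma, HasAntidiagonal.mem_antidiagonal] at h
    obtain ⟨rfl, rfl⟩ := h
    rfl
  · rintro ⟨⟨a, b⟩, ⟨c, e⟩⟩ h
    simp only [mem_sigma, HasAntidiagonal.mem_antidiagonal] at h
    obtain ⟨rfl, rfl⟩ := h
    rfl
  · rintro ⟨⟨a, b⟩, ⟨c, e⟩⟩ h
    rfl

/-- Together with Vandermonde's identity this is the combinatorial content of associativity of
composition. -/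
theorem choose_mul_choose_sub (i : ℤ) (u w : ℕ) :
    Ring.choose i u * Ring.choose (i - u) w
      = ((u + w).choose u : ℤ) * Ring.choose i (u + w) := by
  have h := Ring.choose_smul_choose i (Nat.le_add_right u w)
  rw [Nat.add_sub_cancel_left, nsmul_eq_mul] at h
  exact h.symm

end Leibniz

/-! ### The ring of pseudo-differential operators -/

namespace PsiDO

variable {k : Type u} [CommRing k] {R : Type v} [CommRing R] [Algebra k R]
variable {d : Derivation k R R}

@[simp] theorem coeff_zero (i : ℤ) : (0 : PsiDO d).coeff i = 0 := rfl
@[simp] theorem coeff_add (P Q : PsiDO d) (i : ℤ) :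
    (P + Q).coeff i = P.coeff i + Q.coeff i := rfl
@[simp] theorem coeff_neg (P : PsiDO d) (i : ℤ) : (-P).coeff i = -P.coeff i := rfl
@[simp] theorem coeff_sub (P Q : PsiDO d) (i : ℤ) :
    (P - Q).coeff i = P.coeff i - Q.coeff i := rfl
theorem coeff_monomial (a : R) (i j : ℤ) :
    (monomial a i : PsiDO d).coeff j = if j = i then a else 0 := rfl
theorem coeff_one (j : ℤ) : (1 : PsiDO d).coeff j = if j = 0 then 1 else 0 := rfl
@[simp] theorem coeff_plus (P : PsiDO d) (i : ℤ) :
    P.plus.coeff i = if 0 ≤ i then P.coeff i else 0 := rfl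
@[simp] theorem coeff_minus (P : PsiDO d) (i : ℤ) :
    P.minus.coeff i = if 0 ≤ i then 0 else P.coeff i := by
  simp only [minus, coeff_sub, coeff_plus]
  split_ifs <;> simp

/-- Taking a coefficient, as an additive map. -/
def coeffHom (d : Derivation k R R) (i : ℤ) : PsiDO d →+ R where
  toFun P := P.coeff i
  map_zero' := rfl
  map_add' _ _ := rfl

@[simp] theorem coeffHom_apply (P : PsiDO d) (i : ℤ) : coeffHom d i P = P.coeff i := rfl

theorem coeff_sum {ι : Type*} (s : Finset ι) (f : ι → PsiDO d) (i : ℤ) :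
    (∑ x ∈ s, f x).coeff i = ∑ x ∈ s, (f x).coeff i :=
  map_sum (coeffHom d i) f s

/-- The order of `P` is at most `N`. -/
def OrdLE (P : PsiDO d) (N : ℤ) : Prop := ∀ i, N < i → P.coeff i = 0

theorem OrdLE.mono {P : PsiDO d} {N M : ℤ} (h : P.OrdLE N) (hNM : N ≤ M) : P.OrdLE M :=
  fun i hi => h i (lt_of_le_of_lt hNM hi)

theorem exists_ordLE (P : PsiDO d) : ∃ N, P.OrdLE N := P.exists_bound

theorem OrdLE.add {P Q : PsiDO d} {N : ℤ} (hP : P.OrdLE N) (hQ : Q.OrdLE N) : (P + Q).OrdLE N :=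
  fun i hi => by simp [hP i hi, hQ i hi]

theorem OrdLE.sub {P Q : PsiDO d} {N : ℤ} (hP : P.OrdLE N) (hQ : Q.OrdLE N) : (P - Q).OrdLE N :=
  fun i hi => by simp [hP i hi, hQ i hi]

theorem OrdLE.pred {P : PsiDO d} {N : ℤ} (hP : P.OrdLE N) (h : P.coeff N = 0) :
    P.OrdLE (N - 1) := fun i hi => by
  rcases eq_or_ne i N with rfl | hne
  · exact h
  · exact hP i (by omega)

theorem ordLE_zero (N : ℤ) : (0 : PsiDO d).OrdLE N := fun _ _ => rfl

theorem ordLE_monomial (a : R) (i : ℤ) : (monomial a i : PsiDO d).OrdLE i :=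
  fun j hj => by rw [coeff_monomial, if_neg hj.ne']

theorem eq_zero_of_ordLE {P : PsiDO d} (h : ∀ N, P.OrdLE N) : P = 0 :=
  ext fun i => h (i - 1) i (by omega)

theorem coeff_mul (P Q : PsiDO d) (s : ℤ) :
    (P * Q).coeff s = ∑ᶠ p : ℤ × ℕ, mulTerm P Q s p := rfl

theorem iterate_d_add (l : ℕ) (a b : R) : d^[l] (a + b) = d^[l] a + d^[l] b :=
  Function.Semiconj₂.iterate (f := d) (op := (· + ·)) (fun x y => map_add d x y) l a b

@[simp] theorem iterate_d_zero (l : ℕ) : d^[l] (0 : R) = 0 :=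
  Function.iterate_fixed (map_zero d) l

theorem iterate_d_neg (l : ℕ) (a : R) : d^[l] (-a) = -d^[l] a :=
  (Function.Semiconj.iterate_right (f := fun x : R => -x) (fun x => (map_neg d x).symm) l a).symm

theorem iterate_d_zsmul (l : ℕ) (c : ℤ) (a : R) : d^[l] (c • a) = c • d^[l] a :=
  (Function.Semiconj.iterate_right (f := fun x : R => c • x) (fun x => (map_zsmul d c x).symm)
    l a).symm

theorem mul_add' (P Q S : PsiDO d) : P * (Q + S) = P * Q + P * S := by
  ext s
  rw [coeff_add, coeff_mul, coeff_mul, coeff_mul,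
    ← finsum_add_distrib (finite_mulTerm P Q s) (finite_mulTerm P S s)]
  exact finsum_congr fun p => by simp [mulTerm, mul_add, smul_add]

theorem add_mul' (P Q S : PsiDO d) : (P + Q) * S = P * S + Q * S := by
  ext s
  rw [coeff_add, coeff_mul, coeff_mul, coeff_mul,
    ← finsum_add_distrib (finite_mulTerm P S s) (finite_mulTerm Q S s)]
  exact finsum_congr fun p => by simp [mulTerm, add_mul, smul_add]

theorem zero_mul' (P : PsiDO d) : 0 * P = 0 := by
  have h := add_mul' 0 0 P
  simpa using h

theorem mul_zero' (P : PsiDO d) : P * 0 = 0 := by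
  have h := mul_add' P 0 0
  simpa using h

/-- The cut-off `T` is any bound beyond which the terms vanish. Leaving it free lets callers choose
the length of the sum. -/
theorem coeff_monomial_mul (a : R) (i : ℤ) (Q : PsiDO d) (s : ℤ) (T : ℕ)
    (hT : ∀ l : ℕ, T ≤ l → Q.coeff (s - i + l) = 0) :
    (monomial a i * Q).coeff s
      = ∑ l ∈ Finset.range T, Ring.choose i l • (a * d^[l] (Q.coeff (s - i + l))) := by
  classical
  rw [coeff_mul, finsum_eq_sum_of_support_subset
    (s := (Finset.range T).image fun l => ((i, l) : ℤ × ℕ))]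
  · rw [Finset.sum_image fun a _ b _ h => (Prod.mk.inj h).2]
    exact Finset.sum_congr rfl fun l _ => by simp [mulTerm, coeff_monomial]
  · rintro ⟨j, l⟩ h
    simp only [Finset.coe_image, Finset.coe_range, Set.mem_image, Set.mem_Iio, Prod.mk.injEq]
    rcases eq_or_ne j i with rfl | hj
    · refine ⟨l, ?_, rfl, rfl⟩
      by_contra hl
      exact h (by simp [mulTerm, hT l (not_lt.1 hl)])
    · exact absurd (by simp [mulTerm, coeff_monomial, hj]) h

theorem coeff_mul_monomial (P : PsiDO d) (c : R) (j : ℤ) (s : ℤ) (T : ℕ)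
    (hT : ∀ l : ℕ, T ≤ l → P.coeff (s - j + l) = 0) :
    (P * monomial c j).coeff s
      = ∑ l ∈ Finset.range T, Ring.choose (s - j + l) l • (P.coeff (s - j + l) * d^[l] c) := by
  classical
  rw [coeff_mul, finsum_eq_sum_of_support_subset
    (s := (Finset.range T).image fun l : ℕ => ((s - j + l, l) : ℤ × ℕ))]
  · rw [Finset.sum_image fun a _ b _ h => (Prod.mk.inj h).2]
    refine Finset.sum_congr rfl fun l _ => ?_
    simp only [mulTerm, coeff_monomial]
    rw [if_pos (by ring)]
  · rintro ⟨p, l⟩ h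
    simp only [Finset.coe_image, Finset.coe_range, Set.mem_image, Set.mem_Iio, Prod.mk.injEq]
    by_cases hp : s - p + l = j
    · have hp' : s - j + l = p := by omega
      refine ⟨l, ?_, hp', rfl⟩
      by_contra hl
      have := hT l (not_lt.1 hl)
      rw [hp'] at this
      exact h (by simp [mulTerm, this])
    · exact absurd (by simp [mulTerm, coeff_monomial, hp]) h

theorem OrdLE.mul {P Q : PsiDO d} {N M : ℤ} (hP : P.OrdLE N) (hQ : Q.OrdLE M) :
    (P * Q).OrdLE (N + M) := fun s hs => by
  refine finsum_eq_zero_of_forall_eq_zero ?_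
  rintro ⟨i, l⟩
  by_cases hi : N < i
  · simp [mulTerm, hP i hi]
  · have : M < s - i + l := by omega
    simp [mulTerm, hQ _ this]

theorem coeff_mul_top {P Q : PsiDO d} {N M : ℤ} (hP : P.OrdLE N) (hQ : Q.OrdLE M) :
    (P * Q).coeff (N + M) = P.coeff N * Q.coeff M := by
  rw [coeff_mul, finsum_eq_single _ (N, 0)]
  · simp [mulTerm]
  · rintro ⟨i, l⟩ h
    by_cases hi : N < i
    · simp [mulTerm, hP i hi]
    · have : M < N + M - i + l := by
        by_contra h'
        exact h (by ext <;> simp <;> omega)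
      simp [mulTerm, hQ _ this]

theorem coeff_monomial_mul_monomial (a b : R) (i j : ℤ) (u : ℕ) :
    (monomial a i * monomial b j : PsiDO d).coeff (i + j - u)
      = Ring.choose i u • (a * d^[u] b) := by
  rw [coeff_monomial_mul a i _ _ (u + 1), Finset.sum_range_succ, Finset.sum_eq_zero, zero_add]
  · rw [coeff_monomial, if_pos (by ring)]
  · intro l hl
    rw [coeff_monomial, if_neg (by have := Finset.mem_range.1 hl; omega)]
    simp
  · intro l hl
    rw [coeff_monomial, if_neg (by omega)]

/-- An additive map on operators that vanishes on monomials and on operators of sufficiently low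
order is zero. -/
theorem addHom_eq_zero {G : Type*} [AddCommGroup G] (F : PsiDO d →+ G)
    (hF : ∃ N : ℤ, ∀ P : PsiDO d, P.OrdLE N → F P = 0) (hm : ∀ a i, F (monomial a i) = 0)
    (P : PsiDO d) : F P = 0 := by
  -- The part of `P` above order `N` is a finite sum of monomials, and the remainder has order at
  -- most `N`.
  obtain ⟨N, hN⟩ := hF
  obtain ⟨M, hM⟩ := P.exists_ordLE
  have h0 : F (∑ i ∈ Finset.Icc (N + 1) M, monomial (P.coeff i) i) = 0 := by
    rw [map_sum]
    exact Finset.sum_eq_zero fun i _ => hm _ _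
  have h1 : F (P - ∑ i ∈ Finset.Icc (N + 1) M, monomial (P.coeff i) i) = 0 := by
    refine hN _ fun i hi => ?_
    rw [coeff_sub, coeff_sum]
    by_cases hi' : i ≤ M
    · rw [Finset.sum_eq_single i]
      · simp [coeff_monomial]
      · intro j _ hj
        rw [coeff_monomial, if_neg hj.symm]
      · intro h
        exact absurd (Finset.mem_Icc.2 ⟨by omega, hi'⟩) h
    · rw [hM i (not_le.1 hi'), Finset.sum_eq_zero, sub_zero]
      intro j hj
      rw [coeff_monomial, if_neg]
      have := (Finset.mem_Icc.1 hj).2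
      omega
  rw [map_sub, h0, sub_zero] at h1
  exact h1

/-- Composition as a biadditive map. -/
def mulHom (d : Derivation k R R) : PsiDO d →+ PsiDO d →+ PsiDO d :=
  AddMonoidHom.mk' (fun P => AddMonoidHom.mk' (fun Q => P * Q) (mul_add' P))
    (fun P Q => AddMonoidHom.ext (add_mul' P Q))

-- The coefficients at order `i + j + l - t` are compared. On the right, Leibniz expands `d^p (b *
-- d^q c)`, so both sides become sums over `u + w + q = t` of multiples of `a * d^u b * d^(w+q) c`.
open Finset in
theorem monomial_mul_assoc (a b c : R) (i j l : ℤ) :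
    (monomial a i * monomial b j * monomial c l : PsiDO d)
      = monomial a i * (monomial b j * monomial c l) := by
  ext s
  by_cases hs : i + j + l < s
  · rw [((ordLE_monomial a i).mul (ordLE_monomial b j)).mul (ordLE_monomial c l) s hs,
      (ordLE_monomial a i).mul ((ordLE_monomial b j).mul (ordLE_monomial c l)) s (by omega)]
  obtain ⟨t, rfl⟩ : ∃ t : ℕ, s = i + j + l - t := ⟨(i + j + l - s).toNat, by omega⟩
  rw [coeff_mul_monomial _ c l _ (t + 1), coeff_monomial_mul a i _ _ (t + 1)]
  rotate_left
  · intro p hp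
    exact (ordLE_monomial b j).mul (ordLE_monomial c l) _ (by omega)
  · intro p hp
    exact (ordLE_monomial a i).mul (ordLE_monomial b j) _ (by omega)
  let f : ℕ → ℕ → R := fun u p => a * (d^[u] b * d^[p] c)
  have hL : ∀ p ∈ range (t + 1), Ring.choose (i + j + l - t - l + p : ℤ) p •
      ((monomial a i * monomial b j : PsiDO d).coeff (i + j + l - t - l + p) * d^[p] c)
      = (fun u p : ℕ => (Ring.choose i u * Ring.choose (i - u + j) p) • f u p) (t - p) p := by
    intro p hp
    have h1 : (i + j + l - t - l + p : ℤ) = i + j - (t - p : ℕ) := by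
      have := mem_range.1 hp; omega
    rw [h1, coeff_monomial_mul_monomial, show i + j - ((t - p : ℕ) : ℤ)
      = i - ((t - p : ℕ) : ℤ) + j by ring]
    simp only [f, smul_mul_assoc, smul_smul, mul_assoc]
    rw [mul_comm]
  have hR : ∀ p ∈ range (t + 1), Ring.choose i p •
      (a * d^[p] ((monomial b j * monomial c l : PsiDO d).coeff (i + j + l - t - i + p)))
      = (fun p q : ℕ => ∑ s ∈ antidiagonal p,
        (Ring.choose i s.1 * Ring.choose (i - s.1) s.2 * Ring.choose j q) • f s.1 (s.2 + q))
          p (t - p) := by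
    intro p hp
    have h1 : (i + j + l - t - i + p : ℤ) = j + l - (t - p : ℕ) := by
      have := mem_range.1 hp; omega
    rw [h1, coeff_monomial_mul_monomial, iterate_d_zsmul, iterate_derivation_mul, smul_sum,
      mul_sum, smul_sum]
    refine sum_congr rfl fun s hs => ?_
    have hs' := HasAntidiagonal.mem_antidiagonal.1 hs
    rw [choose_mul_choose_sub, hs', ← Function.iterate_add_apply]
    simp only [f]
    rw [← natCast_zsmul]
    simp only [mul_smul_comm, smul_smul]
    congr 1
    ring
  rw [sum_congr rfl hL, sum_congr rfl hR, ← Nat.sum_antidiagonal_eq_sum_range_succ_mk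
    (f := fun x : ℕ × ℕ => (fun u p : ℕ => (Ring.choose i u * Ring.choose (i - u + j) p) • f u p)
      x.2 x.1), ← Nat.sum_antidiagonal_eq_sum_range_succ
    (fun p q : ℕ => ∑ s ∈ HasAntidiagonal.antidiagonal p,
      (Ring.choose i s.1 * Ring.choose (i - s.1) s.2 * Ring.choose j q) • f s.1 (s.2 + q)),
    ← sum_antidiagonal_assoc fun u w q =>
      (Ring.choose i u * Ring.choose (i - u) w * Ring.choose j q) • f u (w + q),
    ← Nat.sum_antidiagonal_swap]
  refine sum_congr rfl fun x _ => ?_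
  simp only [Prod.fst_swap, Prod.snd_swap]
  -- Vandermonde splits `choose (i - u + j) p` into the products `choose (i - u) w * choose j q`
  -- with `w + q = p`.
  rw [Ring.add_choose_eq _ (Commute.all _ _), mul_sum, sum_smul]
  refine sum_congr rfl fun s hs => ?_
  rw [HasAntidiagonal.mem_antidiagonal.1 hs, mul_assoc]

/-- A fixed coefficient of each side is additive in each factor and vanishes once that factor has
low enough order, so `addHom_eq_zero` reduces the three factors to monomials one at a time. -/
theorem mul_assoc' (P Q S : PsiDO d) : P * Q * S = P * (Q * S) := by
  ext s
  obtain ⟨N, hN⟩ := P.exists_ordLE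
  obtain ⟨M, hM⟩ := Q.exists_ordLE
  obtain ⟨K, hK⟩ := S.exists_ordLE
  rw [← sub_eq_zero]
  refine addHom_eq_zero (d := d) (AddMonoidHom.mk' (fun P => (P * Q * S).coeff s
    - (P * (Q * S)).coeff s) ?_) ⟨s - M - K - 1, ?_⟩ ?_ P
  · intro P P'
    simp only [add_mul', coeff_add]
    ring
  · intro P hP
    simp only [AddMonoidHom.mk'_apply]
    rw [(hP.mul hM).mul hK s (by omega), hP.mul (hM.mul hK) s (by omega), sub_zero]
  intro a i
  refine addHom_eq_zero (d := d) (AddMonoidHom.mk' (fun Q => (monomial a i * Q * S).coeff s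
    - (monomial a i * (Q * S)).coeff s) ?_) ⟨s - i - K - 1, ?_⟩ ?_ Q
  · intro P P'
    simp only [add_mul', mul_add', coeff_add]
    ring
  · intro P hP
    simp only [AddMonoidHom.mk'_apply]
    rw [((ordLE_monomial a i).mul hP).mul hK s (by omega),
      (ordLE_monomial a i).mul (hP.mul hK) s (by omega), sub_zero]
  intro b j
  refine addHom_eq_zero (d := d) (AddMonoidHom.mk'
    (fun S => (monomial a i * monomial b j * S).coeff s - (monomial a i * (monomial b j * S)).coeff s) ?_) ⟨s - i - j - 1, ?_⟩ ?_ S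
  · intro P P'
    simp only [mul_add', coeff_add]
    ring
  · intro P hP
    simp only [AddMonoidHom.mk'_apply]
    rw [((ordLE_monomial a i).mul (ordLE_monomial b j)).mul hP s (by omega),
      (ordLE_monomial a i).mul ((ordLE_monomial b j).mul hP) s (by omega), sub_zero]
  intro c l
  simp only [AddMonoidHom.mk'_apply, monomial_mul_assoc, sub_self]

theorem coeff_const_mul (a : R) (P : PsiDO d) (s : ℤ) :
    (monomial a 0 * P).coeff s = a * P.coeff s := by
  obtain ⟨M, hM⟩ := P.exists_ordLE
  rw [coeff_monomial_mul a 0 P s ((M - s).toNat + 1), Finset.sum_range_succ', Finset.sum_eq_zero]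
  · simp
  · intro l _
    simp
  · intro l hl
    exact hM _ (by omega)

theorem one_mul' (P : PsiDO d) : 1 * P = P :=
  ext fun s => (coeff_const_mul 1 P s).trans (one_mul _)

theorem iterate_d_one_succ (l : ℕ) : d^[l + 1] (1 : R) = 0 := by
  rw [Function.iterate_succ_apply, Derivation.map_one_eq_zero, iterate_d_zero]

theorem coeff_mul_monomial_one (P : PsiDO d) (j s : ℤ) :
    (P * monomial 1 j).coeff s = P.coeff (s - j) := by
  obtain ⟨M, hM⟩ := P.exists_ordLE
  rw [coeff_mul_monomial P 1 j s ((M - s + j).toNat + 1), Finset.sum_range_succ',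
    Finset.sum_eq_zero]
  · simp
  · intro l _
    rw [iterate_d_one_succ]
    simp
  · intro l hl
    exact hM _ (by omega)

theorem mul_one' (P : PsiDO d) : P * 1 = P :=
  ext fun s => (coeff_mul_monomial_one P 0 s).trans (by rw [sub_zero])

/-- Pseudo-differential operators form a ring. -/
instance : Ring (PsiDO d) where
  __ := (inferInstance : AddCommGroup (PsiDO d))
  mul_assoc := mul_assoc'
  one_mul := one_mul'
  mul_one := mul_one'
  left_distrib := mul_add'
  right_distrib := add_mul'
  zero_mul := zero_mul'
  mul_zero := mul_zero'
  npow r P := npowRec r P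

end PsiDO

/-! ### The Adler map in a ring with an isotropic splitting -/

section Adler

variable {S G : Type*} [Ring S] [AddCommGroup G]

/-- A splitting `x = p x + (x - p x)` of a ring into two isotropic subrings, with respect to a
trace `τ`. -/
structure IsotropicSplitting (p : S →+ S) (τ : S →+ G) : Prop where
  trace_comm : ∀ x y, τ (x * y) = τ (y * x)
  plus_mul_plus : ∀ x y, p (p x * p y) = p x * p y
  minus_mul_minus : ∀ x y, p ((x - p x) * (y - p y)) = 0
  trace_plus : ∀ x y, τ (p x * p y) = 0
  trace_minus : ∀ x y, τ ((x - p x) * (y - p y)) = 0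

/-- The Adler map. -/
def adler (p : S →+ S) (l x : S) : S := p (l * x) * l - l * p (x * l)

/-- The derivative of the Adler map with respect to `l` in the direction `y`. -/
def adlerDeriv (p : S →+ S) (l y x : S) : S :=
  p (y * x) * l + p (l * x) * y - (y * p (x * l) + l * p (x * y))

namespace IsotropicSplitting

variable {p : S →+ S} {τ : S →+ G} (h : IsotropicSplitting p τ)
include h

/-- The two projections are adjoint: by isotropy both sides equal the trace of `p x * (y - p y)`. -/
theorem trace_plus_mul (x y : S) : τ (p x * y) = τ (x * (y - p y)) := by
  have h1 := h.trace_plus x y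
  have h2 := h.trace_minus x y
  simp only [mul_sub, sub_mul, map_sub] at h1 h2 ⊢
  rw [h1] at h2
  linear_combination (norm := abel) -h2

theorem adler_skew (l x y : S) : τ (adler p l x * y) = -τ (adler p l y * x) := by
  have e : ∀ x y, τ (adler p l x * y)
      = τ (p (l * x) * (l * y)) - τ (p (x * l) * (y * l)) := by
    intro x y
    simp only [adler, sub_mul, map_sub, mul_assoc]
    rw [h.trace_comm l, mul_assoc]
  have e1 := h.trace_plus_mul (l * x) (l * y)
  have e2 := h.trace_plus_mul (x * l) (y * l)
  have e3 : τ (l * x * (l * y)) = τ (x * l * (y * l)) := by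
    rw [mul_assoc, h.trace_comm l]; simp only [mul_assoc]
  have e4 := h.trace_comm (l * x) (p (l * y))
  have e5 := h.trace_comm (x * l) (p (y * l))
  rw [e, e]
  simp only [mul_sub, map_sub] at e1 e2
  linear_combination (norm := abel) e1 - e2 + e3 - e4 + e5

/-- The ten terms are grouped by what they depend on: three involve only `l * a`, `l * b`, `l * c`,
three only `a * l`, `b * l`, `c * l`, and four are mixed. The mixed terms cancel in the cyclic sum
over `a, b, c`, and the other two groups are handled by `cyclic_left` and `cyclic_right`. -/
theorem trace_adlerDeriv (l a b c : S) :
    τ (adlerDeriv p l (adler p l a) b * c)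
      = τ (p (l * a) * (l * b) * (l * c - p (l * c)))
        + τ (p (l * b) * p (l * a) * (l * c))
        - τ (p (l * a) * (l * c) * (l * b))
        + τ (p (a * l) * p (b * l) * (c * l))
        + τ (b * l * p (a * l) * (c * l - p (c * l)))
        - τ (p (a * l) * (b * l) * (c * l))
        + τ (p (l * c) * (l * (p (a * l) * b)))
        - τ (p (l * b) * (l * (p (a * l) * c)))
        - τ (p (l * a) * (l * (p (b * l) * c)))
        + τ (p (l * a) * (l * (p (c * l) * b))) := by
  have e1 : τ (p (adler p l a * b) * l * c) = τ (p (l * a) * (l * b) * (l * c - p (l * c)))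
      - τ (l * p (a * l) * b * (l * c - p (l * c))) := by
    rw [mul_assoc, h.trace_plus_mul, ← map_sub, ← sub_mul]
    simp only [adler, sub_mul, mul_assoc]
  have e2 : τ (l * p (a * l) * b * (l * c - p (l * c)))
      = τ (p (a * l) * (b * l) * (c * l)) - τ (p (l * c) * (l * (p (a * l) * b))) := by
    rw [mul_sub, map_sub]
    congr 1
    · rw [mul_assoc, mul_assoc, h.trace_comm l]; simp only [mul_assoc]
    · rw [h.trace_comm]; simp only [mul_assoc]
  have e3 : τ (p (l * b) * adler p l a * c) = τ (p (l * b) * p (l * a) * (l * c))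
      - τ (p (l * b) * (l * (p (a * l) * c))) := by
    rw [← map_sub]
    simp only [adler, sub_mul, mul_sub, mul_assoc]
  have e4 : τ (adler p l a * p (b * l) * c) = τ (p (l * a) * (l * (p (b * l) * c)))
      - τ (p (a * l) * p (b * l) * (c * l)) := by
    rw [h.trace_comm (p (a * l) * p (b * l)), mul_assoc c, h.trace_comm c, ← map_sub]
    simp only [adler, sub_mul, mul_assoc]
  have e5 : τ (l * p (b * adler p l a) * c) = τ (b * p (l * a) * l * (c * l - p (c * l)))
      - τ (b * l * p (a * l) * (c * l - p (c * l))) := by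
    rw [mul_assoc, h.trace_comm l, mul_assoc, h.trace_plus_mul, ← map_sub, ← sub_mul]
    simp only [adler, sub_mul, mul_sub, mul_assoc]
  have e6 : τ (b * p (l * a) * l * (c * l - p (c * l)))
      = τ (p (l * a) * (l * c) * (l * b)) - τ (p (l * a) * (l * (p (c * l) * b))) := by
    rw [mul_assoc, mul_assoc, h.trace_comm b, ← map_sub]
    simp only [mul_sub, sub_mul, mul_assoc]
  rw [adlerDeriv, sub_mul, add_mul, add_mul, map_sub, map_add, map_add]
  linear_combination (norm := abel) e1 - e2 + e3 - e4 - e5 - e6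

theorem trace_plus_plus_plus (x y z : S) : τ (p x * p y * p z) = 0 := by
  rw [← h.plus_mul_plus]
  exact h.trace_plus _ _

theorem trace_minus_minus_minus (x y z : S) :
    τ ((x - p x) * (y - p y) * (z - p z)) = 0 := by
  have := h.trace_minus ((x - p x) * (y - p y)) z
  rwa [h.minus_mul_minus, sub_zero] at this

theorem trace_rotate (x y z : S) : τ (x * y * z) = τ (y * z * x) := by
  rw [mul_assoc, h.trace_comm]

/-- After rotating the factors under the trace, what is left is a combination of pure plus and pure
minus triple products, whose traces vanish. -/
theorem cyclic_left (x y z : S) :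
    τ (p x * y * (z - p z)) + τ (p y * p x * z) - τ (p x * z * y)
    + (τ (p y * z * (x - p x)) + τ (p z * p y * x) - τ (p y * x * z))
    + (τ (p z * x * (y - p y)) + τ (p x * p z * y) - τ (p z * y * x))
      = τ (x * y * z) - τ (x * z * y) := by
  have t1 := h.trace_plus_plus_plus x y z
  have t2 := h.trace_plus_plus_plus x z y
  have t3 := h.trace_minus_minus_minus x y z
  have t4 := h.trace_minus_minus_minus x z y
  have r := h.trace_rotate
  have r' : ∀ u v w, τ (u * v * w) = τ (w * u * v) := fun u v w => (r w u v).symm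
  simp only [mul_sub, sub_mul, map_sub] at t3 t4 ⊢
  rw [r (p y) (p x) z, r' (p y) z x, r' (p y) z (p x), r' (p z) (p y) x, r (p y) x z,
    r (p z) x y, r (p z) x (p y), r' (p z) y x]
  linear_combination (norm := abel) t4 - t3 - t1 + t2

/-- The value is opposite to that of `cyclic_left`. The two cancel in the Schouten bracket because
the trace of `l * a * (l * b) * (l * c)` equals that of `a * l * (b * l) * (c * l)`. -/
theorem cyclic_right (x y z : S) :
    τ (p x * p y * z) + τ (y * p x * (z - p z)) - τ (p x * y * z)
    + (τ (p y * p z * x) + τ (z * p y * (x - p x)) - τ (p y * z * x))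
    + (τ (p z * p x * y) + τ (x * p z * (y - p y)) - τ (p z * x * y))
      = τ (x * z * y) - τ (x * y * z) := by
  have t1 := h.trace_plus_plus_plus x y z
  have t2 := h.trace_plus_plus_plus x z y
  have t3 := h.trace_minus_minus_minus x y z
  have t4 := h.trace_minus_minus_minus x z y
  have r := h.trace_rotate
  have r' : ∀ u v w, τ (u * v * w) = τ (w * u * v) := fun u v w => (r w u v).symm
  simp only [mul_sub, sub_mul, map_sub] at t3 t4 ⊢
  rw [r y (p x) z, r y (p x) (p z), r' (p y) (p z) x, r' z (p y) x, r' z (p y) (p x),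
    r' (p y) z x, r (p z) (p x) y, r (p z) x y]
  linear_combination (norm := abel) t3 - t4 + t1 - t2

/-- The Schouten bracket of the Adler map with itself vanishes. -/
theorem adler_schouten (l a b c : S) :
    τ (adlerDeriv p l (adler p l a) b * c) + τ (adlerDeriv p l (adler p l b) c * a)
      + τ (adlerDeriv p l (adler p l c) a * b) = 0 := by
  have e1 := h.cyclic_left (l * a) (l * b) (l * c)
  have e2 := h.cyclic_right (a * l) (b * l) (c * l)
  have e3 : τ (l * a * (l * b) * (l * c)) = τ (a * l * (b * l) * (c * l)) := by
    simp only [mul_assoc]; rw [h.trace_comm l]; simp only [mul_assoc]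
  have e4 : τ (l * a * (l * c) * (l * b)) = τ (a * l * (c * l) * (b * l)) := by
    simp only [mul_assoc]; rw [h.trace_comm l]; simp only [mul_assoc]
  rw [h.trace_adlerDeriv, h.trace_adlerDeriv, h.trace_adlerDeriv]
  linear_combination (norm := abel) e1 + e2 + e3 - e4

/-- Here `G` plays the functionals, `X` the gradient, `D f` the flow of the Hamiltonian vector field
of `f` on operators and `ev f` its action on functionals. The product rule splits each double
bracket into a Schouten term and two terms that differentiate gradients. The latter cancel
cyclically by `symm`, the symmetry of the Hessian, so no commutator of Hamiltonian vector fields is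
needed. -/
theorem adler_jacobi {l : S} {X : G → S} {D : G → S →+ S} {ev : G → G →+ G}
    (leibniz : ∀ f x y, D f (x * y) = D f x * y + x * D f y)
    (map_plus : ∀ f x, D f (p x) = p (D f x))
    (map_l : ∀ f, D f l = adler p l (X f))
    (trace : ∀ f x, τ (D f x) = ev f (τ x))
    (ev_eq : ∀ f g, ev f g = τ (adler p l (X f) * X g))
    (symm : ∀ f g h, τ (adler p l (X f) * D g (X h)) = τ (adler p l (X g) * D f (X h)))
    (f g k : G) :
    τ (adler p l (X f) * X (τ (adler p l (X g) * X k)))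
      + τ (adler p l (X g) * X (τ (adler p l (X k) * X f)))
      + τ (adler p l (X k) * X (τ (adler p l (X f) * X g))) = 0 := by
  have e : ∀ f g k, τ (adler p l (X f) * X (τ (adler p l (X g) * X k)))
      = τ (adlerDeriv p l (adler p l (X f)) (X g) * X k) - τ (adler p l (X k) * D f (X g))
        + τ (adler p l (X g) * D f (X k)) := by
    intro f g k
    have e1 : D f (adler p l (X g))
        = adlerDeriv p l (adler p l (X f)) (X g) + adler p l (D f (X g)) := by
      simp only [adler, adlerDeriv, map_sub, map_add, leibniz, map_plus, map_l, add_mul, mul_add]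
      abel
    rw [← ev_eq, ← trace, leibniz, e1, add_mul, map_add, map_add, h.adler_skew l (D f (X g))]
    abel
  rw [e, e, e]
  linear_combination (norm := abel) h.adler_schouten l (X f) (X g) (X k) + symm g f k + symm k g f
    + symm f k g

end IsotropicSplitting
end Adler

/-! ### The residue trace, and elementary properties of the two operators -/

namespace PsiDO

section

variable {k : Type u} [CommRing k] {R : Type v} [CommRing R] [Algebra k R]
variable {d : Derivation k R R}

/-- `P ↦ P_+` as an additive map. -/
def plusHom (d : Derivation k R R) : PsiDO d →+ PsiDO d where
  toFun := plus
  map_zero' := ext fun i => by simp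
  map_add' P Q := ext fun i => by
    simp only [coeff_plus, coeff_add]
    split_ifs <;> simp

@[simp] theorem plusHom_apply (P : PsiDO d) : plusHom d P = P.plus := rfl

theorem plus_add (P Q : PsiDO d) : (P + Q).plus = P.plus + Q.plus := map_add (plusHom d) P Q
theorem plus_sub (P Q : PsiDO d) : (P - Q).plus = P.plus - Q.plus := map_sub (plusHom d) P Q

theorem ordLE_minus (P : PsiDO d) : P.minus.OrdLE (-1) := fun i hi => by
  rw [coeff_minus, if_pos (by omega)]

theorem plus_eq_zero {P : PsiDO d} (h : P.OrdLE (-1)) : P.plus = 0 := ext fun i => by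
  rw [coeff_plus]
  split_ifs with hi
  · exact h i (by omega)
  · rfl

theorem plus_mul_plus (P Q : PsiDO d) : (P.plus * Q.plus).plus = P.plus * Q.plus := by
  ext s
  rw [coeff_plus]
  split_ifs with hs
  · rfl
  symm
  refine finsum_eq_zero_of_forall_eq_zero ?_
  rintro ⟨i, l⟩
  simp only [mulTerm, coeff_plus]
  split_ifs with hi hj
  · obtain ⟨i, rfl⟩ := Int.eq_ofNat_of_zero_le hi
    have : i < l := by omega
    rw [Ring.choose_natCast, Nat.choose_eq_zero_of_lt this]
    simp
  all_goals simp

/-- Repeated integration by parts, modulo derivatives. -/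
theorem d_iterate_mem_range (n : ℕ) (a b : R) :
    a * d^[n] b - (-1) ^ n * (b * d^[n] a) ∈ ((d : R →ₗ[k] R).toAddMonoidHom).range := by
  induction n generalizing a with
  | zero => simp [mul_comm]
  | succ n ih =>
    have h1 : d (a * d^[n] b) ∈ ((d : R →ₗ[k] R).toAddMonoidHom).range := ⟨a * d^[n] b, rfl⟩
    convert sub_mem h1 (ih (d a)) using 1
    rw [Derivation.leibniz, Function.iterate_succ_apply' d n b, Function.iterate_succ_apply d n a,
      smul_eq_mul, smul_eq_mul]
    ring

/-- The residue of a commutator is a total derivative. -/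
theorem res_comm_mem_range (P Q : PsiDO d) :
    (P * Q - Q * P).res ∈ ((d : R →ₗ[k] R).toAddMonoidHom).range := by
  obtain ⟨N, hN⟩ := P.exists_ordLE
  obtain ⟨M, hM⟩ := Q.exists_ordLE
  let π := QuotientAddGroup.mk' ((d : R →ₗ[k] R).toAddMonoidHom).range
  rw [← QuotientAddGroup.eq_zero_iff]
  refine addHom_eq_zero (d := d) (AddMonoidHom.mk' (fun P => π (P * Q - Q * P).res) ?_)
    ⟨-1 - M - 1, ?_⟩ ?_ P
  · intro P P'
    rw [← map_add, add_mul, mul_add]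
    congr 1
    simp only [res, coeff_sub, coeff_add]
    ring
  · intro P hP
    simp only [AddMonoidHom.mk'_apply, res, coeff_sub]
    rw [hP.mul hM _ (by omega), hM.mul hP _ (by omega), sub_zero, map_zero]
  intro a i
  refine addHom_eq_zero (d := d) (AddMonoidHom.mk' (fun Q => π (monomial a i * Q
    - Q * monomial a i).res) ?_) ⟨-1 - i - 1, ?_⟩ ?_ Q
  · intro P P'
    rw [← map_add, add_mul, mul_add]
    congr 1
    simp only [res, coeff_sub, coeff_add]
    ring
  · intro P hP
    simp only [AddMonoidHom.mk'_apply, res, coeff_sub]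
    rw [hP.mul (ordLE_monomial a i) _ (by omega), (ordLE_monomial a i).mul hP _ (by omega),
      sub_zero, map_zero]
  intro b j
  simp only [AddMonoidHom.mk'_apply, res, coeff_sub]
  by_cases hij : i + j < -1
  · rw [(ordLE_monomial b j).mul (ordLE_monomial a i) _ (by omega),
      (ordLE_monomial a i).mul (ordLE_monomial b j) _ (by omega), sub_zero, map_zero]
  -- For two monomials with `i + j = n - 1`, only the term with `n` derivatives reaches order `-1`.
  obtain ⟨n, hn⟩ : ∃ n : ℕ, j = n - 1 - i := ⟨(i + j + 1).toNat, by omega⟩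
  have e1 := coeff_monomial_mul_monomial (d := d) a b i j n
  have e2 := coeff_monomial_mul_monomial (d := d) b a j i n
  rw [show i + j - n = -1 by omega] at e1
  rw [show j + i - n = -1 by omega] at e2
  -- Upper negation of the binomial coefficient. Its sign is the one produced by `n` integrations by
  -- parts.
  have e3 : Ring.choose j n = (-1) ^ n * Ring.choose i n := by
    rw [hn, show (n - 1 - i : ℤ) = -(i - n + 1) by ring, Ring.choose_neg,
      show i - n + 1 + n - 1 = i by ring, Int.negOnePow_def]
    simp [Units.smul_def]
  refine (QuotientAddGroup.eq_zero_iff _).2 ?_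
  rw [e1, e2, e3]
  convert zsmul_mem (d_iterate_mem_range (d := d) n a b) (Ring.choose i n) using 1
  simp only [zsmul_eq_mul]
  push_cast
  ring

theorem isotropicSplitting {G : Type*} [AddCommGroup G] (t : R →+ G) (ht : ∀ a, t (d a) = 0) :
    IsotropicSplitting (plusHom d) (t.comp (coeffHom d (-1))) where
  trace_comm P Q := by
    rw [← sub_eq_zero, ← map_sub]
    obtain ⟨a, ha⟩ := res_comm_mem_range P Q
    exact (congrArg t ha.symm).trans (ht a)
  plus_mul_plus := plus_mul_plus
  minus_mul_minus P Q :=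
    plus_eq_zero (((ordLE_minus P).mul (ordLE_minus Q)).mono (by norm_num))
  trace_plus P Q := by
    rw [plusHom_apply, plusHom_apply, ← plus_mul_plus]
    simp
  trace_minus P Q := by
    have := ((ordLE_minus P).mul (ordLE_minus Q)) (-1) (by norm_num)
    exact (congrArg t this).trans (map_zero t)

/-- The Adler map produces operators of lower order. -/
theorem ordLE_H0 {L : PsiDO d} {N : ℤ} (hL : L.OrdLE N) (P : PsiDO d) :
    (H0 L P).OrdLE (N - 1) := by
  -- The two copies of `L * P * L` cancel, so plus parts may be traded for minus parts, which have
  -- order at most `-1`.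
  have h : H0 L P = L * (P * L).minus - (L * P).minus * L := by
    simp only [H0, minus, mul_sub, sub_mul, mul_assoc]
    abel
  rw [h]
  refine (hL.mul (ordLE_minus _)).sub (((ordLE_minus _).mul hL).mono (by omega))

/-- The commutator of two minus parts has no plus part, and that of two plus parts is its own plus
part. In this form the second term drops out when `P` commutes with `L`. -/
theorem Hinf_eq_comm (L P : PsiDO d) : Hinf L P = comm L P.plus - (comm L P).plus := by
  have e1 : comm L P.plus = comm L.minus P.plus + comm L.plus P.plus := by
    simp only [comm, minus, sub_mul, mul_sub]
    abel
  have e2 : comm L P = comm L P.plus + comm L.plus P.minus + comm L.minus P.minus := by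
    simp only [comm, minus, mul_sub, sub_mul]
    abel
  have e3 : (comm L.minus P.minus).plus = 0 :=
    plus_eq_zero ((((ordLE_minus L).mul (ordLE_minus P)).sub
      ((ordLE_minus P).mul (ordLE_minus L))).mono (by norm_num))
  have e4 : (comm L.plus P.plus).plus = comm L.plus P.plus := by
    rw [comm, plus_sub, plus_mul_plus, plus_mul_plus]
  rw [Hinf, e2, plus_add, plus_add, e3, e1, plus_add, e4, minus]
  abel

/-- `H^{(∞)}` is minus the derivative of the Adler map with respect to shifts of `ℒ` by
constants. -/
theorem H0_add_central {L C : PsiDO d} (hC : ∀ P, C * P = P * C)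
    (hC' : ∀ P : PsiDO d, (C * P).plus = C * P.plus) (P : PsiDO d) :
    H0 (L + C) P = H0 L P - C * Hinf L P := by
  rw [Hinf_eq_comm]
  have h2 : ∀ P : PsiDO d, (P * C).plus = C * P.plus := fun P => by rw [← hC, hC']
  -- The terms quadratic in `C` cancel because `C` is central and commutes with taking the plus
  -- part, so the shift is affine in `C`.
  simp only [H0, comm, add_mul, mul_add, plus_add, plus_sub, hC', h2, mul_sub]
  simp only [← hC, ← mul_assoc]
  simp only [mul_assoc]
  abel

end

end PsiDO

/-! ### Monic operators, their roots and inverses, and maps of coefficients -/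

namespace PsiDO

section

variable {k : Type u} [CommRing k] {R : Type v} [CommRing R] [Algebra k R]
variable {d : Derivation k R R}
variable {k' : Type u} [CommRing k'] {R' : Type w} [CommRing R'] [Algebra k' R']
variable {d' : Derivation k' R' R'}

/-! ### Orders and leading coefficients -/

/-- The order is lowered one step at a time: above `K`, the top coefficient always vanishes. -/
theorem ordLE_of_forall_top {P : PsiDO d} {K : ℤ}
    (h : ∀ j, K < j → P.OrdLE j → P.coeff j = 0) : P.OrdLE K := by
  obtain ⟨N, hN⟩ := P.exists_ordLE
  have key : ∀ n : ℕ, P.OrdLE (max K (N - n)) := by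
    intro n
    induction n with
    | zero => exact hN.mono (by simp)
    | succ n ih =>
      rcases le_or_gt (N - n) K with hK | hK
      · rw [max_eq_left hK] at ih
        exact ih.mono (le_max_left _ _)
      · rw [max_eq_right hK.le] at ih
        exact (ih.pred (h _ hK ih)).mono ((by push_cast; omega : N - n - 1 ≤ N - (n + 1 : ℕ)).trans
          (le_max_right _ _))
  exact (key (N - K).toNat).mono (max_le le_rfl (by omega))

theorem eq_zero_of_forall_top {P : PsiDO d} (h : ∀ j, P.OrdLE j → P.coeff j = 0) : P = 0 :=
  eq_zero_of_ordLE fun _ => ordLE_of_forall_top fun j _ => h j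

theorem isMonic_one : (1 : PsiDO d).IsMonic 0 :=
  ⟨by simp [coeff_one], fun i hi => by rw [coeff_one, if_neg hi.ne']⟩

theorem isMonic_monomial (i : ℤ) : (monomial 1 i : PsiDO d).IsMonic i :=
  ⟨by simp [coeff_monomial], ordLE_monomial 1 i⟩

theorem IsMonic.ordLE {P : PsiDO d} {N : ℤ} (h : P.IsMonic N) : P.OrdLE N := h.2

theorem IsMonic.mul {P Q : PsiDO d} {N M : ℤ} (hP : P.IsMonic N) (hQ : Q.IsMonic M) :
    (P * Q).IsMonic (N + M) :=
  ⟨by rw [coeff_mul_top hP.2 hQ.2, hP.1, hQ.1, one_mul], OrdLE.mul hP.2 hQ.2⟩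

theorem IsMonic.pow {P : PsiDO d} (hP : P.IsMonic 1) (n : ℕ) : (P ^ n).IsMonic n := by
  induction n with
  | zero => simpa using isMonic_one
  | succ n ih =>
    rw [pow_succ]
    push_cast
    exact ih.mul hP

theorem IsMonic.add {P E : PsiDO d} {N j : ℤ} (hP : P.IsMonic N) (hE : E.OrdLE j) (hj : j < N) :
    (P + E).IsMonic N :=
  ⟨by rw [coeff_add, hP.1, hE N hj, add_zero], hP.ordLE.add (hE.mono hj.le)⟩

theorem IsMonic.sub_ordLE {P Q : PsiDO d} {N : ℤ} (hP : P.IsMonic N) (hQ : Q.IsMonic N) :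
    (P - Q).OrdLE (N - 1) :=
  (hP.ordLE.sub hQ.ordLE).pred (by rw [coeff_sub, hP.1, hQ.1, sub_self])

/-- First variation of the power map. -/
theorem add_pow_sub_pow {K E : PsiDO d} {j : ℤ} (hK : K.IsMonic 1) (hE : E.OrdLE j) (hj : j < 1)
    (n : ℕ) : ((K + E) ^ n - K ^ n).OrdLE (n - 1 + j) ∧
      ((K + E) ^ n - K ^ n).coeff (n - 1 + j) = n * E.coeff j := by
  induction n with
  | zero => simp [ordLE_zero]
  | succ n ih =>
    have e : (K + E) ^ (n + 1) - K ^ (n + 1) = ((K + E) ^ n - K ^ n) * (K + E) + K ^ n * E := by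
      rw [pow_succ, pow_succ, sub_mul, mul_add (K ^ n)]
      abel
    have h1 := (hK.add hE hj)
    have i1 : ((n + 1 : ℕ) : ℤ) - 1 + j = n - 1 + j + 1 := by push_cast; ring
    have i2 : (n : ℤ) - 1 + j + 1 = n + j := by ring
    rw [e, i1]
    refine ⟨(ih.1.mul h1.ordLE).add (i2 ▸ (hK.pow n).ordLE.mul hE), ?_⟩
    rw [coeff_add, coeff_mul_top ih.1 h1.ordLE, ih.2, h1.1, i2,
      coeff_mul_top (hK.pow n).ordLE hE, (hK.pow n).1]
    push_cast
    ring

/-- If the difference of the two roots has order at most `j`, then `n` times its coefficient at `j`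
is the top coefficient of the difference of the powers, hence zero. As `n` is invertible, the
coefficient itself vanishes. -/
theorem pow_injective {n : ℕ} {c : R} (hc : c * n = 1) {K K' : PsiDO d} (hK : K.IsMonic 1)
    (hK' : K'.IsMonic 1) (h : K' ^ n = K ^ n) : K' = K := by
  rw [← sub_eq_zero]
  refine eq_zero_of_forall_top fun j hj => ?_
  by_cases hj1 : j < 1
  · have := (add_pow_sub_pow hK hj hj1 n).2
    rw [add_sub_cancel, h, sub_self, coeff_zero] at this
    rw [← one_mul ((K' - K).coeff j), ← hc, mul_assoc, ← this, mul_zero]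
  · exact hK'.sub_ordLE hK j (by omega)

/-- A map that satisfies the Leibniz rule kills a monic operator if it kills a power of it. -/
theorem eq_zero_of_leibniz_pow {n : ℕ} {c : R} (hc : c * n = 1) {K : PsiDO d} (hK : K.IsMonic 1)
    (δ : PsiDO d →+ PsiDO d) (hδ : ∀ P Q, δ (P * Q) = δ P * Q + P * δ Q) (h : δ (K ^ n) = 0) :
    δ K = 0 := by
  have h1 : δ 1 = 0 := by simpa using hδ 1 1
  refine eq_zero_of_forall_top fun j hj => ?_
  -- The linearised form of `add_pow_sub_pow`: commuting factors on top order give `n` times the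
  -- leading coefficient of `δ K`.
  have key : ∀ n : ℕ, (δ (K ^ n)).OrdLE (n - 1 + j) ∧
      (δ (K ^ n)).coeff (n - 1 + j) = n * (δ K).coeff j := by
    intro n
    induction n with
    | zero => simp [h1, ordLE_zero]
    | succ n ih =>
      have i1 : ((n + 1 : ℕ) : ℤ) - 1 + j = n - 1 + j + 1 := by push_cast; ring
      have i2 : (n : ℤ) - 1 + j + 1 = n + j := by ring
      rw [pow_succ, hδ, i1]
      refine ⟨(ih.1.mul hK.ordLE).add (i2 ▸ (hK.pow n).ordLE.mul hj), ?_⟩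
      rw [coeff_add, coeff_mul_top ih.1 hK.ordLE, ih.2, hK.1, i2,
        coeff_mul_top (hK.pow n).ordLE hj, (hK.pow n).1]
      push_cast
      ring
  have := (key n).2
  rw [h, coeff_zero] at this
  rw [← one_mul ((δ K).coeff j), ← hc, mul_assoc, ← this, mul_zero]

theorem leibniz_pow_eq_zero {K : PsiDO d} (δ : PsiDO d →+ PsiDO d)
    (hδ : ∀ P Q, δ (P * Q) = δ P * Q + P * δ Q) (h : δ K = 0) (n : ℕ) : δ (K ^ n) = 0 := by
  induction n with
  | zero => simpa using hδ 1 1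
  | succ n ih => rw [pow_succ, hδ, ih, h]; simp

/-! ### Operators with coefficients in a differential subring -/

/-- All coefficients of `P` lie in `B`. -/
def CoeffsIn (B : Subring R) (P : PsiDO d) : Prop := ∀ i, P.coeff i ∈ B

theorem CoeffsIn.add {B : Subring R} {P Q : PsiDO d} (hP : P.CoeffsIn B) (hQ : Q.CoeffsIn B) :
    (P + Q).CoeffsIn B := fun i => add_mem (hP i) (hQ i)

theorem CoeffsIn.sub {B : Subring R} {P Q : PsiDO d} (hP : P.CoeffsIn B) (hQ : Q.CoeffsIn B) :
    (P - Q).CoeffsIn B := fun i => sub_mem (hP i) (hQ i)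

theorem coeffsIn_monomial {B : Subring R} {a : R} (ha : a ∈ B) (i : ℤ) :
    (monomial a i : PsiDO d).CoeffsIn B := fun j => by
  rw [coeff_monomial]
  split_ifs
  exacts [ha, zero_mem B]

theorem CoeffsIn.plus {B : Subring R} {P : PsiDO d} (hP : P.CoeffsIn B) :
    P.plus.CoeffsIn B := fun i => by
  rw [coeff_plus]
  split_ifs
  exacts [hP i, zero_mem B]

theorem CoeffsIn.minus {B : Subring R} {P : PsiDO d} (hP : P.CoeffsIn B) :
    P.minus.CoeffsIn B := hP.sub hP.plus

theorem CoeffsIn.mul {B : Subring R} (hB : ∀ a ∈ B, d a ∈ B) {P Q : PsiDO d} (hP : P.CoeffsIn B)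
    (hQ : Q.CoeffsIn B) : (P * Q).CoeffsIn B := fun s => by
  refine finsum_induction (· ∈ B) (zero_mem B) (fun _ _ => add_mem) fun p => ?_
  have hit : ∀ (l : ℕ) (a : R), a ∈ B → d^[l] a ∈ B := by
    intro l
    induction l with
    | zero => exact fun a ha => ha
    | succ l ih => exact fun a ha => ih _ (hB a ha)
  exact zsmul_mem (mul_mem (hP _) (hit _ _ (hQ _))) _

theorem CoeffsIn.pow {B : Subring R} (hB : ∀ a ∈ B, d a ∈ B) {P : PsiDO d} (hP : P.CoeffsIn B)
    (n : ℕ) : (P ^ n).CoeffsIn B := by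
  induction n with
  | zero => exact coeffsIn_monomial (one_mem B) 0
  | succ n ih => rw [pow_succ]; exact ih.mul hB hP

theorem CoeffsIn.H0 {B : Subring R} (hB : ∀ a ∈ B, d a ∈ B) {P Q : PsiDO d} (hP : P.CoeffsIn B)
    (hQ : Q.CoeffsIn B) : (H0 P Q).CoeffsIn B :=
  ((hP.mul hB hQ).plus.mul hB hP).sub (hP.mul hB (hQ.mul hB hP).plus)

theorem CoeffsIn.comm {B : Subring R} (hB : ∀ a ∈ B, d a ∈ B) {P Q : PsiDO d}
    (hP : P.CoeffsIn B) (hQ : Q.CoeffsIn B) : (comm P Q).CoeffsIn B :=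
  (hP.mul hB hQ).sub (hQ.mul hB hP)

theorem CoeffsIn.Hinf {B : Subring R} (hB : ∀ a ∈ B, d a ∈ B) {P Q : PsiDO d}
    (hP : P.CoeffsIn B) (hQ : Q.CoeffsIn B) : (Hinf P Q).CoeffsIn B :=
  (hP.minus.comm hB hQ.plus).minus.sub (hP.plus.comm hB hQ.minus).plus

/-! ### Solving equations by successive approximation -/

/-- By `hF`, a correction of order `j < N` changes `F` first at order `c + j`, where it acts as
multiplication by the invertible `κ`. The error can thus be removed one order at a time, with all
coefficients staying in `B`. -/
theorem exists_solution {B : Subring R} (F : PsiDO d → PsiDO d) {c N : ℤ} {κ ι : R}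
    (hκ : κ * ι = 1) (hι : ι ∈ B) {K₀ T : PsiDO d} (hT : T.CoeffsIn B) (hK₀ : K₀.CoeffsIn B)
    (hFB : ∀ K, K.CoeffsIn B → (F K).CoeffsIn B) (hF₀ : (T - F K₀).OrdLE (c + N - 1))
    (hF : ∀ K E : PsiDO d, ∀ j, (K - K₀).OrdLE (N - 1) → E.OrdLE j → j < N →
      (F (K + E) - F K).OrdLE (c + j) ∧ (F (K + E) - F K).coeff (c + j) = κ * E.coeff j) :
    ∃ K, K.CoeffsIn B ∧ (K - K₀).OrdLE (N - 1) ∧ F K = T := by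
  let step : ℕ → PsiDO d → PsiDO d := fun n K =>
    K + monomial (ι * (T - F K).coeff (c + N - 1 - n)) (N - 1 - n)
  let A : ℕ → PsiDO d := fun n => Nat.rec K₀ step n
  have hA : ∀ n, A (n + 1)
      = A n + monomial (ι * (T - F (A n)).coeff (c + N - 1 - n)) (N - 1 - n) := fun n => rfl
  have inv : ∀ n, (A n).CoeffsIn B ∧ (A n - K₀).OrdLE (N - 1)
      ∧ (T - F (A n)).OrdLE (c + N - 1 - n) := by
    intro n
    induction n with
    | zero => exact ⟨hK₀, by change (K₀ - K₀).OrdLE _; rw [sub_self]; exact ordLE_zero _,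
        hF₀.mono (by simp)⟩
    | succ n ih =>
      obtain ⟨h1, h2, h3⟩ := ih
      have hE := ordLE_monomial (d := d) (ι * (T - F (A n)).coeff (c + N - 1 - n)) (N - 1 - n)
      have h4 := hF (A n) _ _ h2 hE (by omega)
      rw [← hA, show c + (N - 1 - n) = c + N - 1 - n by ring] at h4
      refine ⟨?_, ?_, ?_⟩
      · rw [hA]
        exact h1.add (coeffsIn_monomial (mul_mem hι ((hT.sub (hFB _ h1)) _)) _)
      · rw [hA, add_sub_right_comm]
        exact h2.add (hE.mono (by omega))
      · have e : T - F (A (n + 1)) = T - F (A n) - (F (A (n + 1)) - F (A n)) := by abel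
        have := (h3.sub h4.1).pred (by
          rw [coeff_sub, h4.2, coeff_monomial, if_pos rfl, ← mul_assoc, hκ, one_mul, sub_self])
        rw [e]
        exact this.mono (by push_cast; omega)
  have stab : ∀ (n p : ℕ) (i : ℤ), N - n ≤ i → (A (n + p)).coeff i = (A n).coeff i := by
    intro n p i hi
    induction p with
    | zero => rfl
    | succ p ih =>
      rw [← add_assoc, hA, coeff_add, ih, coeff_monomial, if_neg (by push_cast; omega), add_zero]
  -- Step `n` alters only the coefficient of order `N - 1 - n`, so the coefficient of order `i` is
  -- final from `A (N - i)` on. For `i ≥ N` the value `toNat = 0` gives the coefficient of `K₀`.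
  let K : PsiDO d := ⟨fun i => (A (N - i).toNat).coeff i, by
    obtain ⟨M, hM⟩ := K₀.exists_bound
    refine ⟨max M N, fun i hi => ?_⟩
    have : (N - i).toNat = 0 := by have := le_max_right M N; omega
    beta_reduce
    rw [this]
    exact hM i (lt_of_le_of_lt (le_max_left _ _) hi)⟩
  have hKA : ∀ n, (K - A n).OrdLE (N - 1 - n) := by
    intro n i hi
    have h1 := stab (N - i).toNat (n - (N - i).toNat) i (by omega)
    rw [Nat.add_sub_cancel' (by omega)] at h1
    rw [coeff_sub, h1]
    exact sub_self _
  refine ⟨K, fun i => (inv _).1 i, ?_, ?_⟩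
  · have : K - K₀ = K - A 0 := rfl
    rw [this]
    simpa using hKA 0
  · rw [eq_comm, ← sub_eq_zero]
    refine eq_zero_of_ordLE fun M => ?_
    let n : ℕ := (c + N - 1 - M).toNat
    have h1 := (hF (A n) _ _ (inv n).2.1 (hKA n) (by omega)).1
    have e : T - F K = T - F (A n) - (F (A n + (K - A n)) - F (A n)) := by
      rw [add_sub_cancel]; abel
    rw [e]
    exact ((inv n).2.2.mono (by omega)).sub (h1.mono (by omega))

/-- Monic operators have monic roots. -/
theorem exists_root {B : Subring R} (hB : ∀ a ∈ B, d a ∈ B) {n : ℕ} {c : R} (hc : c * n = 1)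
    (hcB : c ∈ B) {T : PsiDO d} (hT : T.IsMonic n) (hTB : T.CoeffsIn B) :
    ∃ K : PsiDO d, K.CoeffsIn B ∧ K.IsMonic 1 ∧ K ^ n = T := by
  -- The iteration starts from `∂`. By `add_pow_sub_pow`, a correction of order `j` changes the
  -- power at order `n - 1 + j` by the factor `n`, whose inverse is `c`.
  obtain ⟨K, h1, h2, h3⟩ := exists_solution (B := B) (fun K : PsiDO d => K ^ n) (c := n - 1)
    (N := 1) (κ := n) (ι := c) (by rw [mul_comm, hc]) hcB (K₀ := monomial 1 1) hTB
    (coeffsIn_monomial (one_mem B) 1) (fun K hK => hK.pow hB n)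
    ((hT.sub_ordLE ((isMonic_monomial 1).pow n)).mono (by omega))
    (fun K E j hK hE hj => by
      have : K.IsMonic 1 := by
        have := (isMonic_monomial (d := d) 1).add hK (by omega)
        rwa [add_sub_cancel] at this
      exact add_pow_sub_pow this hE hj n)
  refine ⟨K, h1, ?_, h3⟩
  have := (isMonic_monomial (d := d) 1).add h2 (by omega)
  rwa [add_sub_cancel] at this

theorem exists_right_inv {T : PsiDO d} {N : ℤ} (hT : T.IsMonic N) :
    ∃ K : PsiDO d, K.IsMonic (-N) ∧ T * K = 1 := by
  obtain ⟨K, -, h2, h3⟩ := exists_solution (B := ⊤) (fun K : PsiDO d => T * K) (c := N)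
    (N := -N) (κ := 1) (ι := 1) (one_mul 1) trivial (K₀ := monomial 1 (-N)) (T := 1)
    (fun _ => trivial) (fun _ => trivial) (fun _ _ _ => trivial)
    (isMonic_one.sub_ordLE (by simpa using hT.mul (isMonic_monomial (-N))) |>.mono (by omega))
    (fun K E j hK hE hj => by
      rw [mul_add, add_sub_cancel_left]
      exact ⟨hT.ordLE.mul hE, by rw [coeff_mul_top hT.ordLE hE, hT.1]⟩)
  refine ⟨K, ?_, h3⟩
  have := (isMonic_monomial (d := d) (-N)).add h2 (by omega)
  rwa [add_sub_cancel] at this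

/-- Monic operators are invertible. -/
theorem exists_inv {T : PsiDO d} {N : ℤ} (hT : T.IsMonic N) :
    ∃ K : PsiDO d, T * K = 1 ∧ K * T = 1 := by
  obtain ⟨K, hK, h1⟩ := exists_right_inv hT
  obtain ⟨T', -, h2⟩ := exists_right_inv hK
  -- The right inverse of a right inverse coincides with the original operator.
  exact ⟨K, h1, by rwa [← left_inv_eq_right_inv h1 h2] at h2⟩

/-! ### Maps of coefficients -/

theorem coeff_mapCoeff (φ : R →+ R') (P : PsiDO d) (i : ℤ) :
    (P.mapCoeff φ : PsiDO d').coeff i = φ (P.coeff i) := rfl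

theorem mapCoeff_add (φ : R →+ R') (P Q : PsiDO d) :
    ((P + Q).mapCoeff φ : PsiDO d') = P.mapCoeff φ + Q.mapCoeff φ := ext fun _ => map_add φ _ _

theorem mapCoeff_plus (φ : R →+ R') (P : PsiDO d) :
    (P.plus.mapCoeff φ : PsiDO d') = (P.mapCoeff φ).plus := ext fun i => by
  simp only [coeff_mapCoeff, coeff_plus, apply_ite φ, map_zero]

/-- Substitution by a differential ring homomorphism, as a ring homomorphism. -/
def mapRingHom (φ : R →+* R') (hφ : ∀ a, φ (d a) = d' (φ a)) : PsiDO d →+* PsiDO d' where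
  toFun P := P.mapCoeff φ.toAddMonoidHom
  map_zero' := ext fun _ => map_zero φ
  map_one' := ext fun i => by
    rw [coeff_mapCoeff, coeff_one, coeff_one]
    split_ifs
    exacts [map_one φ, map_zero φ]
  map_add' P Q := mapCoeff_add _ P Q
  map_mul' P Q := ext fun s => by
    rw [coeff_mapCoeff, coeff_mul, coeff_mul, AddMonoidHom.map_finsum _ (finite_mulTerm P Q s)]
    refine finsum_congr fun p => ?_
    have hit : ∀ (l : ℕ) (a : R), φ (d^[l] a) = d'^[l] (φ a) := fun l a =>
      (Function.Semiconj.iterate_right hφ l a)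
    simp [mulTerm, coeff_mapCoeff, hit]

end

/-! ### Time derivatives of operators -/

section TimeDeriv

variable {A : Type u} [CommRing A] {R : Type v} [CommRing R] [Algebra A R]
variable {d : Derivation A R R}

/-- The time derivative of operators as an additive map. -/
def timeDerivHom (D : Derivation A R R) : PsiDO d →+ PsiDO d where
  toFun P := timeDeriv D P
  map_zero' := ext fun _ => map_zero D
  map_add' P Q := mapCoeff_add _ P Q

theorem coeff_timeDeriv (D : Derivation A R R) (P : PsiDO d) (i : ℤ) :
    (timeDeriv D P).coeff i = D (P.coeff i) := rfl

theorem timeDeriv_mul {D : Derivation A R R} (hD : ∀ a, D (d a) = d (D a)) (P Q : PsiDO d) :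
    timeDeriv D (P * Q) = timeDeriv D P * Q + P * timeDeriv D Q := ext fun s => by
  rw [coeff_timeDeriv, coeff_add, coeff_mul, coeff_mul, coeff_mul,
    ← finsum_add_distrib (finite_mulTerm _ _ s) (finite_mulTerm _ _ s)]
  refine (AddMonoidHom.map_finsum (D : R →ₗ[A] R).toAddMonoidHom (finite_mulTerm P Q s)).trans ?_
  refine finsum_congr fun p => ?_
  have hit : ∀ (l : ℕ) (a : R), D (d^[l] a) = d^[l] (D a) := fun l a =>
    (Function.Semiconj.iterate_right hD l a)
  simp [mulTerm, coeff_timeDeriv, hit]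
  ring

end TimeDeriv

end PsiDO

/-! ### Differential polynomials: the trace, evolutionary derivations and the first variation -/

section DiffPoly

variable {A : Type u} [CommRing A] [Algebra ℝ A] {n m : ℕ}

/-! ### The trace form on differential polynomials -/

theorem coeff_trPoly (ω : TraceForm A) (F : DiffPoly m n A) (s : JetVar m n →₀ ℕ) :
    (trPoly ω F).coeff s = ω.tr (F.coeff s) := by
  classical
  rw [trPoly, coeff_sum]
  simp only [coeff_monomial]
  rw [Finset.sum_ite_eq']
  split_ifs with h
  · rfl
  · rw [notMem_support_iff.1 h, map_zero]

/-- `trPoly` as a linear map. -/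
def trPolyHom (ω : TraceForm A) (m n : ℕ) : DiffPoly m n A →ₗ[ℝ] DiffPoly m n ℝ where
  toFun := trPoly ω
  map_add' F G := by ext s; simp [coeff_trPoly]
  map_smul' c F := by ext s; simp [coeff_trPoly]

theorem trPoly_add (ω : TraceForm A) (F G : DiffPoly m n A) :
    trPoly ω (F + G) = trPoly ω F + trPoly ω G := map_add (trPolyHom ω m n) F G

theorem trPoly_sum (ω : TraceForm A) {ι : Type*} (s : Finset ι) (F : ι → DiffPoly m n A) :
    trPoly ω (∑ i ∈ s, F i) = ∑ i ∈ s, trPoly ω (F i) := map_sum (trPolyHom ω m n) F s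

/-- Extension of scalars of a real differential polynomial. -/
abbrev baseExt (A : Type u) [CommRing A] [Algebra ℝ A] {m n : ℕ} :
    DiffPoly m n ℝ →+* DiffPoly m n A :=
  map (algebraMap ℝ A)

/-- `A`-valued differential polynomials are sums of constants in `A` times real ones, so additive
statements need only be checked on such products. -/
theorem diffPoly_induction {P : DiffPoly m n A → Prop} (h : ∀ a F, P (C a * baseExt A F))
    (hadd : ∀ F G, P F → P G → P (F + G)) (F : DiffPoly m n A) : P F := by
  induction F using MvPolynomial.induction_on' with
  | monomial s a =>
    have := h a (MvPolynomial.monomial s 1)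
    rwa [map_monomial, map_one, C_mul_monomial, mul_one] at this
  | add F G hF hG => exact hadd F G hF hG

theorem trPoly_C_mul_ext (ω : TraceForm A) (a : A) (F : DiffPoly m n ℝ) :
    trPoly ω (C a * baseExt A F) = C (ω.tr a) * F := by
  ext s
  rw [coeff_trPoly, coeff_C_mul, coeff_C_mul, coeff_map, mul_comm, ← Algebra.smul_def, map_smul,
    smul_eq_mul, mul_comm]

theorem trPoly_mul_ext (ω : TraceForm A) (G : DiffPoly m n A) (F : DiffPoly m n ℝ) :
    trPoly ω (G * baseExt A F) = trPoly ω G * F := by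
  induction G using diffPoly_induction with
  | h a G => rw [mul_assoc, ← map_mul, trPoly_C_mul_ext, trPoly_C_mul_ext, mul_assoc]
  | hadd G G' h h' => rw [add_mul, trPoly_add, h, h', trPoly_add, add_mul]

theorem TraceForm.basis_expansion (ω : TraceForm A) (e : Module.Basis (Fin n) ℝ A) (a : A) :
    a = ∑ q, ω.tr (ω.dual e q * a) • e q := by
  have h : ∀ q, ω.tr (ω.dual e q * a) = e.repr a q := by
    intro q
    conv_lhs => rw [← e.sum_repr a]
    rw [Finset.mul_sum, map_sum, Finset.sum_eq_single q]
    · have := LinearMap.BilinForm.apply_dualBasis_left (B := ω.form) ω.nondegenerate e q q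
      rw [mul_smul_comm, map_smul]
      exact (congrArg (e.repr a q • ·) this).trans (by simp)
    · intro j _ hj
      have := LinearMap.BilinForm.apply_dualBasis_left (B := ω.form) ω.nondegenerate e q j
      rw [mul_smul_comm, map_smul]
      exact (congrArg (e.repr a j • ·) this).trans (by simp [hj])
    · simp
  conv_lhs => rw [← e.sum_repr a]
  simp only [h]

theorem TraceForm.dual_expansion (ω : TraceForm A) (e : Module.Basis (Fin n) ℝ A) (a : A) :
    a = ∑ q, ω.tr (e q * a) • ω.dual e q := by
  conv_lhs => rw [← (ω.dual e).sum_repr a]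
  refine Finset.sum_congr rfl fun q _ => ?_
  congr 1
  refine (LinearMap.BilinForm.dualBasis_repr_apply (B := ω.form) ω.nondegenerate e a q).trans ?_
  exact congrArg ω.tr (mul_comm _ _)

/-- Stated for a pair `b`, `b'` because it is used in both directions: with the basis expanded
through its dual, and with the dual expanded through the basis. -/
theorem diffPoly_expansion {ω : TraceForm A} {b b' : Fin n → A}
    (h : ∀ a : A, a = ∑ q, ω.tr (b' q * a) • b q) (F : DiffPoly m n A) :
    F = ∑ q, C (b q) * baseExt A (trPoly ω (C (b' q) * F)) := by
  ext s
  rw [coeff_sum]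
  simp only [coeff_C_mul, coeff_map, coeff_trPoly]
  conv_lhs => rw [h (F.coeff s)]
  exact Finset.sum_congr rfl fun q _ => by rw [Algebra.smul_def, mul_comm]

theorem eq_zero_of_trPoly (ω : TraceForm A) (e : Module.Basis (Fin n) ℝ A) {F : DiffPoly m n A}
    (h : ∀ q, trPoly ω (C (e q) * F) = 0) : F = 0 := by
  rw [diffPoly_expansion (ω.dual_expansion e) F]
  simp [h]

theorem derivation_const_mul {k : Type u} [CommRing k]
    (D : Derivation k (DiffPoly m n k) (DiffPoly m n k)) (a : k) (F : DiffPoly m n k) :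
    D (C a * F) = C a * D F := by
  rw [Derivation.leibniz, derivation_C, smul_zero, add_zero, smul_eq_mul]

theorem ext_mkDerivation (f : JetVar m n → DiffPoly m n ℝ) (F : DiffPoly m n ℝ) :
    baseExt A (mkDerivation ℝ f F) = mkDerivation A (fun p => baseExt A (f p)) (baseExt A F) := by
  induction F using MvPolynomial.induction_on with
  | C a => simp [derivation_C]
  | add F G hF hG => simp only [map_add, hF, hG]
  | mul_X F p hF =>
    simp only [Derivation.leibniz, map_add, smul_eq_mul, map_mul, hF, mkDerivation_X, map_X]

/-- The trace touches only constants in `A`, while a derivation with real characteristic touches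
only the real factor. -/
theorem trPoly_mkDerivation (ω : TraceForm A) (f : JetVar m n → DiffPoly m n ℝ)
    (F : DiffPoly m n A) :
    trPoly ω (mkDerivation A (fun p => baseExt A (f p)) F) = mkDerivation ℝ f (trPoly ω F) := by
  induction F using diffPoly_induction with
  | h a F =>
    rw [derivation_const_mul, ← ext_mkDerivation, trPoly_C_mul_ext, trPoly_C_mul_ext,
      derivation_const_mul]
  | hadd F G hF hG => rw [map_add, trPoly_add, hF, hG, trPoly_add, map_add]

theorem totalD_eq_ext :
    totalD m n A = mkDerivation A (fun p => baseExt A (X (p.1, p.2.1, p.2.2 + 1))) := by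
  simp only [totalD, map_X]

theorem ext_totalD (F : DiffPoly m n ℝ) :
    baseExt A (totalD m n ℝ F) = totalD m n A (baseExt A F) := by
  rw [totalD_eq_ext (A := A)]
  exact ext_mkDerivation _ F

theorem ext_iterate_totalD (j : ℕ) (F : DiffPoly m n ℝ) :
    baseExt A ((totalD m n ℝ)^[j] F) = (totalD m n A)^[j] (baseExt A F) :=
  Function.Semiconj.iterate_right ext_totalD j F

theorem trPoly_totalD (ω : TraceForm A) (F : DiffPoly m n A) :
    trPoly ω (totalD m n A F) = totalD m n ℝ (trPoly ω F) := by
  rw [totalD_eq_ext (A := A)]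
  exact trPoly_mkDerivation ω _ F

/-! ### Evolutionary derivations -/

/-- The evolutionary derivation `∑ ∂^j(z_{iq}) ∂/∂v_{[i]q}^{(j)}` with characteristic `z`. -/
def evo {k : Type u} [CommRing k] (z : Set.Iio (m : ℤ) → Fin n → DiffPoly m n k) :
    Derivation k (DiffPoly m n k) (DiffPoly m n k) :=
  mkDerivation k (fun p => (totalD m n k)^[p.2.2] (z p.1 p.2.1))

theorem evo_X {k : Type u} [CommRing k] (z : Set.Iio (m : ℤ) → Fin n → DiffPoly m n k)
    (p : JetVar m n) : evo z (X p) = (totalD m n k)^[p.2.2] (z p.1 p.2.1) :=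
  mkDerivation_X _ _ _

theorem evo_totalD {k : Type u} [CommRing k] (z : Set.Iio (m : ℤ) → Fin n → DiffPoly m n k)
    (F : DiffPoly m n k) : evo z (totalD m n k F) = totalD m n k (evo z F) := by
  have h : ⁅evo z, totalD m n k⁆ = 0 := by
    refine derivation_ext fun p => ?_
    rw [Derivation.commutator_apply, evo_X, totalD, mkDerivation_X, ← totalD, evo_X,
      Function.iterate_succ_apply', sub_self, Derivation.zero_apply]
  have h2 := congrArg (fun D => D F) h
  simp only [Derivation.commutator_apply, Derivation.zero_apply] at h2
  exact sub_eq_zero.1 h2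

/-- Both sides are derivations. On a jet variable they agree because evolutionary derivations
commute with `totalD`. -/
theorem evo_commutator {k : Type u} [CommRing k]
    (y z : Set.Iio (m : ℤ) → Fin n → DiffPoly m n k) (F : DiffPoly m n k) :
    evo y (evo z F) - evo z (evo y F)
      = evo (fun i q => evo y (z i q) - evo z (y i q)) F := by
  have h : ⁅evo y, evo z⁆ = evo (fun i q => evo y (z i q) - evo z (y i q)) := by
    refine derivation_ext fun p => ?_
    have hit : ∀ (y : Set.Iio (m : ℤ) → Fin n → DiffPoly m n k) (j : ℕ) (G : DiffPoly m n k),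
      evo y ((totalD m n k)^[j] G) = (totalD m n k)^[j] (evo y G) := fun y j G =>
        Function.Semiconj.iterate_right (evo_totalD y) j G
    rw [Derivation.commutator_apply, evo_X, evo_X, evo_X, hit, hit, sub_eq_add_neg,
      sub_eq_add_neg, PsiDO.iterate_d_add, PsiDO.iterate_d_neg]
  have h2 := congrArg (fun D => D F) h
  simpa only [Derivation.commutator_apply] using h2

/-- Extension of scalars of a characteristic. -/
abbrev extChar (A : Type u) [CommRing A] [Algebra ℝ A]
    (y : Set.Iio (m : ℤ) → Fin n → DiffPoly m n ℝ) :
    Set.Iio (m : ℤ) → Fin n → DiffPoly m n A :=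
  fun i q => baseExt A (y i q)

theorem trPoly_evo (ω : TraceForm A) (y : Set.Iio (m : ℤ) → Fin n → DiffPoly m n ℝ)
    (F : DiffPoly m n A) : trPoly ω (evo (extChar A y) F) = evo y (trPoly ω F) := by
  have h : evo (extChar A y)
      = mkDerivation A (fun p => baseExt A ((totalD m n ℝ)^[p.2.2] (y p.1 p.2.1))) := by
    simp only [ext_iterate_totalD, evo]
  rw [h]
  exact trPoly_mkDerivation ω _ F

/-- The action of an evolutionary derivation on functionals. -/
def evoF (y : Set.Iio (m : ℤ) → Fin n → DiffPoly m n ℝ) : Functional m n →ₗ[ℝ] Functional m n :=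
  (exact m n).mapQ (exact m n) (evo y : DiffPoly m n ℝ →ₗ[ℝ] DiffPoly m n ℝ) (by
    rintro _ ⟨f, rfl⟩
    exact ⟨evo y f, (evo_totalD y f).symm⟩)

theorem evoF_integral (y : Set.Iio (m : ℤ) → Fin n → DiffPoly m n ℝ) (f : DiffPoly m n ℝ) :
    evoF y (integral f) = integral (evo y f) := rfl

theorem integral_totalD (f : DiffPoly m n ℝ) : integral (totalD m n ℝ f) = 0 :=
  (Submodule.Quotient.mk_eq_zero _).2 ⟨f, rfl⟩

theorem integral_eq_zero_iff (f : DiffPoly m n ℝ) : integral f = 0 ↔ f ∈ exact m n :=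
  Submodule.Quotient.mk_eq_zero _

theorem integral_sub (f g : DiffPoly m n ℝ) : integral (f - g) = integral f - integral g :=
  map_sub (exact m n).mkQ f g

theorem integral_sum {ι : Type*} (s : Finset ι) (f : ι → DiffPoly m n ℝ) :
    integral (∑ i ∈ s, f i) = ∑ i ∈ s, integral (f i) := map_sum (exact m n).mkQ f s

theorem varDeriv_integral (i : Set.Iio (m : ℤ)) (q : Fin n) (f : DiffPoly m n ℝ) :
    varDeriv i q (integral f) = euler i q f := rfl

theorem negDPow_apply (j : ℕ) (f : DiffPoly m n ℝ) :
    negDPow m n j f = (-1) ^ j * (totalD m n ℝ)^[j] f := by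
  induction j with
  | zero => simp [negDPow]
  | succ j ih =>
    rw [negDPow, pow_succ', Module.End.mul_apply, ← negDPow, ih, Function.iterate_succ_apply',
      LinearMap.neg_apply, Derivation.coeFn_coe, Derivation.leibniz, Derivation.leibniz_pow]
    simp
    ring

theorem integral_mul_negDPow (j : ℕ) (f g : DiffPoly m n ℝ) :
    integral (f * negDPow m n j g) = integral ((totalD m n ℝ)^[j] f * g) := by
  rw [← sub_eq_zero, ← integral_sub, integral_eq_zero_iff, negDPow_apply]
  obtain ⟨h, hh⟩ := PsiDO.d_iterate_mem_range (d := totalD m n ℝ) j f g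
  refine ⟨(-1) ^ j * h, ?_⟩
  have hh' : totalD m n ℝ h
    = f * (totalD m n ℝ)^[j] g - (-1) ^ j * (g * (totalD m n ℝ)^[j] f) := hh
  rw [Derivation.coeFn_coe, Derivation.leibniz, Derivation.leibniz_pow, hh']
  have h1 : ((-1 : DiffPoly m n ℝ) ^ j) * (-1) ^ j = 1 := by rw [← mul_pow]; simp
  simp
  linear_combination (-(g * (totalD m n ℝ)^[j] f)) * h1

/-- Finitely many fields and derivatives occur in a differential polynomial. -/
theorem exists_box (f : DiffPoly m n ℝ) : ∃ (I : Finset (Set.Iio (m : ℤ))) (J : ℕ),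
    f.vars ⊆ I ×ˢ (Finset.univ ×ˢ Finset.range J) := by
  classical
  obtain ⟨J, hJ⟩ := (f.vars.image fun p => p.2.2).bddAbove
  refine ⟨f.vars.image fun p => p.1, J + 1, fun p hp => ?_⟩
  have := hJ (Finset.mem_coe.2 (Finset.mem_image_of_mem (fun p => p.2.2) hp))
  simp only [Finset.mem_product, Finset.mem_univ, true_and, Finset.mem_range]
  exact ⟨Finset.mem_image_of_mem (fun p => p.1) hp, by omega⟩

theorem euler_eq_sum {f : DiffPoly m n ℝ} {I : Finset (Set.Iio (m : ℤ))} {J : ℕ}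
    (h : f.vars ⊆ I ×ˢ (Finset.univ ×ˢ Finset.range J)) (i : Set.Iio (m : ℤ)) (q : Fin n) :
    euler i q f = ∑ j ∈ Finset.range J, negDPow m n j (pderiv (i, q, j) f) := by
  refine finsum_eq_sum_of_support_subset _ fun j hj => ?_
  by_contra hj'
  refine hj ?_
  have h0 : pderiv (i, q, j) f = 0 := pderiv_eq_zero_of_notMem_vars fun hv => hj' (by
    have := h hv
    simp only [Finset.mem_product] at this
    exact Finset.mem_coe.2 this.2.2)
  simp [h0]

theorem euler_eq_zero {f : DiffPoly m n ℝ} {I : Finset (Set.Iio (m : ℤ))} {J : ℕ}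
    (h : f.vars ⊆ I ×ˢ (Finset.univ ×ˢ Finset.range J)) {i : Set.Iio (m : ℤ)} (hi : i ∉ I)
    (q : Fin n) : euler i q f = 0 := by
  rw [euler_eq_sum h]
  refine Finset.sum_eq_zero fun j _ => ?_
  rw [pderiv_eq_zero_of_notMem_vars fun hv => hi (Finset.mem_product.1 (h hv)).1, map_zero]

theorem derivation_sum_apply {ι : Type*} (s : Finset ι)
    (D : ι → Derivation ℝ (DiffPoly m n ℝ) (DiffPoly m n ℝ)) (f : DiffPoly m n ℝ) :
    (∑ i ∈ s, D i) f = ∑ i ∈ s, D i f := by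
  rw [← Derivation.coeFnAddMonoidHom_apply, map_sum, Finset.sum_apply]
  rfl

/-- The first variation of a functional, in terms of its variational derivatives. -/
theorem integral_evo {f : DiffPoly m n ℝ} {I : Finset (Set.Iio (m : ℤ))} {J : ℕ}
    (h : f.vars ⊆ I ×ˢ (Finset.univ ×ˢ Finset.range J))
    (y : Set.Iio (m : ℤ) → Fin n → DiffPoly m n ℝ) :
    integral (evo y f) = ∑ i ∈ I, integral (∑ q, y i q * euler i q f) := by
  -- On the finitely many variables of `f` the evolutionary derivation is a finite combination of
  -- partial derivatives. Integration by parts then moves each `∂^j` off the characteristic.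
  have e : evo y f = (∑ p ∈ I ×ˢ (Finset.univ ×ˢ Finset.range J),
      ((totalD m n ℝ)^[p.2.2] (y p.1 p.2.1)) • pderiv p) f := by
    refine derivation_eq_of_forall_mem_vars fun p hp => ?_
    rw [evo_X, derivation_sum_apply, Finset.sum_eq_single p]
    · simp
    · intro p' _ hp'
      simp [pderiv_X_of_ne hp'.symm]
    · exact fun h' => absurd (h hp) h'
  rw [e, derivation_sum_apply, integral_sum, Finset.sum_product]
  refine Finset.sum_congr rfl fun i _ => ?_
  rw [Finset.sum_product, integral_sum]
  refine Finset.sum_congr rfl fun q _ => ?_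
  rw [euler_eq_sum h, Finset.mul_sum, integral_sum]
  refine Finset.sum_congr rfl fun j _ => ?_
  rw [integral_mul_negDPow]
  rfl

end DiffPoly

/-! ### The gradient and its duality with vector fields -/

section Gradient

variable {A : Type u} [CommRing A] [Algebra ℝ A] {n m : ℕ}

/-- `P ↦ tr ∫ res P dx`. -/
def trace (ω : TraceForm A) : PsiDO (totalD m n A) →+ Functional m n :=
  ((exact m n).mkQ.comp (trPolyHom ω m n)).toAddMonoidHom.comp (PsiDO.coeffHom _ (-1))

theorem trace_apply (ω : TraceForm A) (P : PsiDO (totalD m n A)) :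
    trace ω P = integral (trPoly ω P.res) := rfl

theorem isotropicSplitting_trace (ω : TraceForm A) :
    IsotropicSplitting (PsiDO.plusHom (totalD m n A)) (trace ω) :=
  PsiDO.isotropicSplitting ((exact m n).mkQ.comp (trPolyHom ω m n)).toAddMonoidHom fun a => by
    refine (congrArg integral (trPoly_totalD ω a)).trans (integral_totalD _)

theorem bracket_eq_trace (ω : TraceForm A) (e : Module.Basis (Fin n) ℝ A)
    (H : PsiDO (totalD m n A) → PsiDO (totalD m n A)) (f g : Functional m n) :
    bracket ω e H f g = trace ω (H (grad ω e f) * grad ω e g) := rfl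

/-- The components in the basis `e` of the coefficients of an operator. -/
def char (ω : TraceForm A) (e : Module.Basis (Fin n) ℝ A) (Y : PsiDO (totalD m n A)) :
    Set.Iio (m : ℤ) → Fin n → DiffPoly m n ℝ :=
  fun i q => trPoly ω (C (ω.dual e q) * Y.coeff i)

theorem sum_char (ω : TraceForm A) (e : Module.Basis (Fin n) ℝ A) (Y : PsiDO (totalD m n A))
    (i : Set.Iio (m : ℤ)) : ∑ q, C (e q) * baseExt A (char ω e Y i q) = Y.coeff i :=
  (diffPoly_expansion (ω.basis_expansion e) _).symm

theorem char_sub (ω : TraceForm A) (e : Module.Basis (Fin n) ℝ A) (Y Z : PsiDO (totalD m n A))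
    (i : Set.Iio (m : ℤ)) (q : Fin n) : char ω e (Y - Z) i q = char ω e Y i q - char ω e Z i q := by
  rw [char, PsiDO.coeff_sub, mul_sub]
  exact map_sub (trPolyHom ω m n) _ _

/-- The derivation of operators defined by the vector field `Y`. -/
def flow (ω : TraceForm A) (e : Module.Basis (Fin n) ℝ A) (Y : PsiDO (totalD m n A)) :
    PsiDO (totalD m n A) →+ PsiDO (totalD m n A) :=
  PsiDO.timeDerivHom (evo (extChar A (char ω e Y)))

variable (ω : TraceForm A) (e : Module.Basis (Fin n) ℝ A)

theorem coeff_flow (Y P : PsiDO (totalD m n A)) (i : ℤ) :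
    (flow ω e Y P).coeff i = evo (extChar A (char ω e Y)) (P.coeff i) := rfl

theorem flow_mul (Y P Q : PsiDO (totalD m n A)) :
    flow ω e Y (P * Q) = flow ω e Y P * Q + P * flow ω e Y Q :=
  PsiDO.timeDeriv_mul (evo_totalD _) P Q

theorem flow_plus (Y P : PsiDO (totalD m n A)) :
    flow ω e Y P.plus = (flow ω e Y P).plus := PsiDO.mapCoeff_plus _ P

/-- The fields are exactly the coefficients of `ℒ` below order `m`, so every operator of order at
most `m - 1` is the velocity of `ℒ` under its own flow. -/
theorem flow_genericL {Y : PsiDO (totalD m n A)} (hY : Y.OrdLE (m - 1)) :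
    flow ω e Y (genericL e m) = Y := by
  ext1 i
  rw [coeff_flow]
  change evo _ (if h : i < (m : ℤ) then jetV e ⟨i, h⟩ 0 else if i = m then 1 else 0) = _
  split_ifs with h1 h2
  · rw [jetV, map_sum, ← sum_char ω e Y ⟨i, h1⟩]
    exact Finset.sum_congr rfl fun q _ => by rw [derivation_const_mul, evo_X]; rfl
  · rw [Derivation.map_one_eq_zero, hY i (by omega)]
  · rw [map_zero, hY i (by omega)]

theorem flow_const (Y : PsiDO (totalD m n A)) (a : A) (i : ℤ) :
    flow ω e Y (PsiDO.monomial (C a) i) = 0 := by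
  ext1 j
  rw [coeff_flow, PsiDO.coeff_monomial]
  split_ifs
  · rw [derivation_C]; rfl
  · rw [map_zero]; rfl

theorem trace_flow (Y P : PsiDO (totalD m n A)) :
    trace ω (flow ω e Y P) = evoF (char ω e Y) (trace ω P) := by
  rw [trace_apply, trace_apply, evoF_integral, ← trPoly_evo]
  rfl

theorem gradV_eq_zero {f : DiffPoly m n ℝ} {I : Finset (Set.Iio (m : ℤ))} {J : ℕ}
    (h : f.vars ⊆ I ×ˢ (Finset.univ ×ˢ Finset.range J)) {i : Set.Iio (m : ℤ)} (hi : i ∉ I) :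
    gradV ω e (integral f) i = 0 :=
  Finset.sum_eq_zero fun q _ => by rw [varDeriv_integral, euler_eq_zero h hi, map_zero, mul_zero]

theorem grad_eq_sum {f : DiffPoly m n ℝ} {I : Finset (Set.Iio (m : ℤ))} {J : ℕ}
    (h : f.vars ⊆ I ×ˢ (Finset.univ ×ˢ Finset.range J)) :
    grad ω e (integral f) = ∑ i ∈ I, (PsiDO.monomial 1 (-(i : ℤ) - 1) : PsiDO (totalD m n A))
      * PsiDO.monomial (gradV ω e (integral f) i) 0 := by
  refine finsum_eq_sum_of_support_subset _ fun i hi => ?_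
  by_contra hi'
  refine hi ?_
  have h0 : (PsiDO.monomial 0 0 : PsiDO (totalD m n A)) = 0 := PsiDO.ext fun j => by
    rw [PsiDO.coeff_monomial, ite_self]; rfl
  beta_reduce
  rw [gradV_eq_zero ω e h hi', h0, mul_zero]

/-- The coefficient `a` is arbitrary and need not be killed by `d`. Terms with `l + 1` derivatives
of `a` carry the binomial `choose l (l + 1) = 0`. -/
theorem PsiDO.res_mul_const {k : Type u} [CommRing k] {R : Type v} [CommRing R]
    [Algebra k R] {d : Derivation k R R} (P : PsiDO d) (a : R) :
    (P * PsiDO.monomial a 0).res = P.res * a := by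
  obtain ⟨M, hM⟩ := P.exists_ordLE
  rw [PsiDO.res, PsiDO.coeff_mul_monomial P a 0 (-1) ((M + 1).toNat + 1), Finset.sum_range_succ',
    Finset.sum_eq_zero]
  · simp [PsiDO.res]
  · intro l _
    rw [show (-1 - 0 + ((l + 1 : ℕ) : ℤ)) = (l : ℕ) by push_cast; ring, Ring.choose_natCast,
      Nat.choose_eq_zero_of_lt (Nat.lt_succ_self l)]
    simp
  · intro l hl
    exact hM _ (by omega)

theorem trPoly_coeff_mul_gradV (Y : PsiDO (totalD m n A)) (f : Functional m n)
    (i : Set.Iio (m : ℤ)) :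
    trPoly ω (Y.coeff i * gradV ω e f i) = ∑ q, char ω e Y i q * varDeriv i q f := by
  rw [gradV, Finset.mul_sum, trPoly_sum]
  refine Finset.sum_congr rfl fun q _ => ?_
  rw [← mul_assoc, trPoly_mul_ext, mul_comm (Y.coeff i)]
  rfl

/-- The gradient represents the first variation. -/
theorem trace_mul_grad (Y : PsiDO (totalD m n A)) (f : Functional m n) :
    trace ω (Y * grad ω e f) = evoF (char ω e Y) f := by
  obtain ⟨f, rfl⟩ := (exact m n).mkQ_surjective f
  change trace ω (Y * grad ω e (integral f)) = evoF (char ω e Y) (integral f)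
  obtain ⟨I, J, h⟩ := exists_box f
  rw [grad_eq_sum ω e h, Finset.mul_sum, map_sum, evoF_integral, integral_evo h]
  refine Finset.sum_congr rfl fun i _ => ?_
  -- Right multiplication by `∂^{-i-1}` shifts orders, so the residue picks out the coefficient of
  -- `∂^i` in `Y`.
  rw [trace_apply, ← mul_assoc, PsiDO.res_mul_const, PsiDO.res, PsiDO.coeff_mul_monomial_one,
    show (-1 - (-(i : ℤ) - 1)) = i by ring, trPoly_coeff_mul_gradV]
  rfl

/-- The second variation is symmetric. -/
theorem trace_second_variation (Y Z : PsiDO (totalD m n A)) (f : Functional m n) :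
    trace ω (Z * flow ω e Y (grad ω e f)) = trace ω (Y * flow ω e Z (grad ω e f)) := by
  have h1 : ∀ Y Z, evoF (char ω e Y) (evoF (char ω e Z) f)
      = trace ω (flow ω e Y Z * grad ω e f) + trace ω (Z * flow ω e Y (grad ω e f)) := by
    intro Y Z
    rw [← trace_mul_grad ω e Z f, ← trace_flow, flow_mul, map_add]
  -- The commutator of the two flows is the flow of `flow_Y Z - flow_Z Y`. Comparing it with the
  -- product-rule expansions in `h1` leaves just the two Hessian terms.
  have h2 : evoF (char ω e Y) (evoF (char ω e Z) f) - evoF (char ω e Z) (evoF (char ω e Y) f)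
      = trace ω (flow ω e Y Z * grad ω e f) - trace ω (flow ω e Z Y * grad ω e f) := by
    rw [← map_sub, ← sub_mul, trace_mul_grad]
    obtain ⟨f, rfl⟩ := (exact m n).mkQ_surjective f
    change integral (evo _ (evo _ f)) - integral (evo _ (evo _ f)) = integral (evo _ f)
    rw [← integral_sub, evo_commutator]
    congr 3
    funext i q
    rw [char_sub]
    have h3 : ∀ Y Z : PsiDO (totalD m n A),
        evo (char ω e Y) (char ω e Z i q) = char ω e (flow ω e Y Z) i q := by
      intro Y Z
      rw [char, ← trPoly_evo, derivation_const_mul]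
      rfl
    rw [h3, h3]
  rw [h1, h1] at h2
  linear_combination (norm := abel) h2

/-! ### The gradient is determined by the first variation -/

/-- There are infinitely many fields, so some `v_{[i]q}` does not occur in `f`. Testing with `g =
v_{[i]q}` gives a functional whose variational derivative in that field is `f`. -/
theorem eq_zero_of_integral_mul (q : Fin n) {f : DiffPoly m n ℝ}
    (h : ∀ g : DiffPoly m n ℝ, integral (g * f) = 0) : f = 0 := by
  obtain ⟨I, J, hI⟩ := exists_box f
  have : Infinite (Set.Iio (m : ℤ)) := (Set.Iio_infinite (m : ℤ)).to_subtype
  obtain ⟨i, hi⟩ := Infinite.exists_notMem_finset I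
  have h1 := congrArg (varDeriv i q) (h (X (i, q, 0)))
  have h2 : ∀ j, pderiv (i, q, j) f = 0 := fun j =>
    pderiv_eq_zero_of_notMem_vars fun hv => hi (Finset.mem_product.1 (hI hv)).1
  have h3 : euler i q (X (i, q, 0) * f) = f := by
    refine (finsum_eq_single _ 0 fun j hj => ?_).trans ?_
    · rw [Derivation.leibniz, h2, pderiv_X_of_ne (by simpa using hj.symm)]
      simp
    · rw [Derivation.leibniz, h2, pderiv_X_self]
      simp [negDPow]
  rw [varDeriv_integral, h3, map_zero] at h1
  exact h1

/-- Fields of order at most `m - 1` detect every coefficient of `Z` of order at least `-m`. -/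
theorem ordLE_of_trace_eq_zero (ω : TraceForm A) (e : Module.Basis (Fin n) ℝ A)
    {Z : PsiDO (totalD m n A)}
    (h : ∀ Y : PsiDO (totalD m n A), Y.OrdLE (m - 1) → trace ω (Y * Z) = 0) :
    Z.OrdLE (-m - 1) := by
  refine PsiDO.ordLE_of_forall_top fun j hj hZ => ?_
  refine eq_zero_of_trPoly ω e fun q => eq_zero_of_integral_mul q fun g => ?_
  -- When `Z` has order at most `j`, this test operator brings its top coefficient to order `-1`,
  -- without derivatives. It is admissible since `j ≥ -m`.
  have h1 := h (PsiDO.monomial (C (e q) * baseExt A g) 0 * PsiDO.monomial 1 (-1 - j)) (by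
    have := (PsiDO.ordLE_monomial (d := totalD m n A) (C (e q) * baseExt A g) 0).mul
      (PsiDO.ordLE_monomial 1 (-1 - j))
    exact this.mono (by omega))
  have h2 := PsiDO.coeff_mul_top (PsiDO.ordLE_monomial (d := totalD m n A) 1 (-1 - j)) hZ
  rw [show -1 - j + j = -1 by ring, PsiDO.coeff_monomial, if_pos rfl, one_mul] at h2
  rw [mul_assoc, trace_apply, PsiDO.res, PsiDO.coeff_const_mul, h2, mul_right_comm,
    trPoly_mul_ext, mul_comm] at h1
  exact h1

end Gradient

/-! ### Linearity of the two operators -/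

namespace PsiDO

variable {k : Type u} [CommRing k] {R : Type v} [CommRing R] [Algebra k R]
variable {d : Derivation k R R}

theorem mul_const_comm {a : R} (ha : d a = 0) (P : PsiDO d) :
    monomial a 0 * P = P * monomial a 0 := by
  ext s
  obtain ⟨M, hM⟩ := P.exists_ordLE
  rw [coeff_const_mul, coeff_mul_monomial P a 0 s ((M - s).toNat + 1), Finset.sum_range_succ',
    Finset.sum_eq_zero]
  · simp [mul_comm]
  · intro l _
    rw [Function.iterate_succ_apply, ha, iterate_d_zero]
    simp
  · intro l hl
    exact hM _ (by omega)

theorem plus_const_mul (a : R) (P : PsiDO d) :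
    (monomial a 0 * P).plus = monomial a 0 * P.plus := ext fun i => by
  rw [coeff_const_mul, coeff_plus, coeff_plus, coeff_const_mul, mul_ite, mul_zero]

theorem H0_add (L P Q : PsiDO d) : H0 L (P + Q) = H0 L P + H0 L Q := by
  simp only [H0, mul_add, add_mul, plus_add]
  abel

theorem H0_sub (L P Q : PsiDO d) : H0 L (P - Q) = H0 L P - H0 L Q := by
  simp only [H0, mul_sub, sub_mul, plus_sub]
  abel

theorem H0_const_mul {a : R} (ha : d a = 0) (L P : PsiDO d) :
    H0 L (monomial a 0 * P) = monomial a 0 * H0 L P := by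
  simp only [H0, mul_sub]
  rw [← mul_assoc L, ← mul_const_comm ha L, mul_assoc, mul_assoc, plus_const_mul, plus_const_mul,
    ← mul_assoc L, ← mul_const_comm ha L, mul_assoc, mul_assoc]

/-- The case of the shift by `1`, through which `H^{(∞)}` inherits additivity, homogeneity and order
bounds from `H^{(0)}`. -/
theorem Hinf_eq (L P : PsiDO d) : Hinf L P = H0 L P - H0 (L + 1) P := by
  rw [H0_add_central (fun P => by simp) (fun P => by simp)]
  simp

theorem Hinf_add (L P Q : PsiDO d) : Hinf L (P + Q) = Hinf L P + Hinf L Q := by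
  simp only [Hinf_eq, H0_add]
  abel

theorem Hinf_sub (L P Q : PsiDO d) : Hinf L (P - Q) = Hinf L P - Hinf L Q := by
  simp only [Hinf_eq, H0_sub]
  abel

theorem Hinf_const_mul {a : R} (ha : d a = 0) (L P : PsiDO d) :
    Hinf L (monomial a 0 * P) = monomial a 0 * Hinf L P := by
  simp only [Hinf_eq, H0_const_mul ha, mul_sub]

theorem ordLE_Hinf {L : PsiDO d} {N : ℤ} (hL : L.OrdLE N) (hN : 0 ≤ N) (P : PsiDO d) :
    (Hinf L P).OrdLE (N - 1) := by
  rw [Hinf_eq]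
  exact (ordLE_H0 hL P).sub (ordLE_H0 (hL.add (isMonic_one.ordLE.mono hN)) P)

end PsiDO

/-! ### The Poisson pencil -/

section Hamiltonian

variable {A : Type u} [CommRing A] [Algebra ℝ A] {n m : ℕ}

/-- A real constant, as an operator. -/
def const (A : Type u) [CommRing A] [Algebra ℝ A] {m n : ℕ} (c : ℝ) : PsiDO (totalD m n A) :=
  PsiDO.monomial (C (algebraMap ℝ A c)) 0

theorem totalD_C {A : Type u} [CommRing A] (a : A) : totalD m n A (C a) = 0 := derivation_C _ a

theorem const_mul_comm (c : ℝ) (P : PsiDO (totalD m n A)) : const A c * P = P * const A c :=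
  PsiDO.mul_const_comm (totalD_C _) P

theorem ordLE_genericL (e : Module.Basis (Fin n) ℝ A) (m : ℕ) : (genericL e m).OrdLE m :=
  fun i hi => by
    change (if h : i < (m : ℤ) then jetV e ⟨i, h⟩ 0 else if i = m then 1 else 0) = _
    rw [dif_neg hi.not_gt, if_neg hi.ne']

variable (ω : TraceForm A) (e : Module.Basis (Fin n) ℝ A)

theorem trace_const_mul (c : ℝ) (P : PsiDO (totalD m n A)) :
    trace ω (const A c * P) = c • trace ω P := by
  rw [trace_apply, trace_apply, PsiDO.res, const, PsiDO.coeff_const_mul, C_mul',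
    algebraMap_smul]
  exact map_smul ((exact m n).mkQ.comp (trPolyHom ω m n)) c _

theorem finite_support_grad (f : Functional m n) :
    (Function.support fun i : Set.Iio (m : ℤ) =>
      (PsiDO.monomial 1 (-(i : ℤ) - 1) : PsiDO (totalD m n A))
        * PsiDO.monomial (gradV ω e f i) 0).Finite := by
  obtain ⟨f, rfl⟩ := (exact m n).mkQ_surjective f
  obtain ⟨I, J, h⟩ := exists_box f
  refine I.finite_toSet.subset fun i hi => ?_
  by_contra hi'
  refine hi ?_
  have h0 : (PsiDO.monomial 0 0 : PsiDO (totalD m n A)) = 0 := PsiDO.ext fun j => by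
    rw [PsiDO.coeff_monomial, ite_self]; rfl
  beta_reduce
  rw [show (exact m n).mkQ f = integral f from rfl, gradV_eq_zero ω e h hi', h0, mul_zero]

theorem grad_add (f g : Functional m n) : grad ω e (f + g) = grad ω e f + grad ω e g := by
  rw [grad, grad, grad, ← finsum_add_distrib (finite_support_grad ω e f)
    (finite_support_grad ω e g)]
  refine finsum_congr fun i => ?_
  rw [← mul_add]
  congr 1
  ext1 j
  rw [PsiDO.coeff_add, PsiDO.coeff_monomial, PsiDO.coeff_monomial, PsiDO.coeff_monomial]
  split_ifs
  · simp only [gradV, map_add, mul_add, Finset.sum_add_distrib]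
  · rw [add_zero]

theorem grad_smul (c : ℝ) (f : Functional m n) : grad ω e (c • f) = const A c * grad ω e f := by
  rw [grad, grad]
  refine Eq.trans ?_ ((AddMonoidHom.mulLeft (const A c)).map_finsum
    (finite_support_grad ω e f)).symm
  refine finsum_congr fun i => ?_
  rw [AddMonoidHom.coe_mulLeft, ← mul_assoc, const_mul_comm, mul_assoc]
  congr 1
  ext1 j
  rw [const, PsiDO.coeff_const_mul, PsiDO.coeff_monomial, PsiDO.coeff_monomial]
  split_ifs
  · rw [gradV, gradV, Finset.mul_sum]
    refine Finset.sum_congr rfl fun q _ => ?_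
    rw [map_smul, MvPolynomial.smul_eq_C_mul, map_mul, map_C]
    ring
  · rw [mul_zero]

/-- The bracket of an `ℝ`-linear operator as a bilinear map. -/
def bracketHom (H : PsiDO (totalD m n A) → PsiDO (totalD m n A))
    (hadd : ∀ P Q, H (P + Q) = H P + H Q) (hsmul : ∀ c P, H (const A c * P) = const A c * H P) :
    Functional m n →ₗ[ℝ] Functional m n →ₗ[ℝ] Functional m n :=
  LinearMap.mk₂ ℝ (bracket ω e H)
    (fun f g h => by simp only [bracket_eq_trace, grad_add, hadd, add_mul, map_add])
    (fun c f g => by simp only [bracket_eq_trace, grad_smul, hsmul, mul_assoc, trace_const_mul])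
    (fun f g h => by simp only [bracket_eq_trace, grad_add, mul_add, map_add])
    (fun c f g => by
      rw [bracket_eq_trace, bracket_eq_trace, grad_smul, ← mul_assoc, ← const_mul_comm, mul_assoc,
        trace_const_mul])

/-- The bracket of `H^{(0)}`. -/
def bracket0 (m : ℕ) : Functional m n →ₗ[ℝ] Functional m n →ₗ[ℝ] Functional m n :=
  bracketHom ω e (PsiDO.H0 (genericL e m)) (PsiDO.H0_add _)
    (fun _ => PsiDO.H0_const_mul (totalD_C _) _)

/-- The bracket of `H^{(∞)}`. -/
def bracketInf (m : ℕ) : Functional m n →ₗ[ℝ] Functional m n →ₗ[ℝ] Functional m n :=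
  bracketHom ω e (PsiDO.Hinf (genericL e m)) (PsiDO.Hinf_add _)
    (fun _ => PsiDO.Hinf_const_mul (totalD_C _) _)

/-- Every bracket of this affine family is the Adler bracket at a shifted operator, so a single
Jacobi argument covers them all. -/
theorem trace_H0_shift (c : ℝ) (f g : Functional m n) :
    trace ω (PsiDO.H0 (genericL e m + const A c) (grad ω e f) * grad ω e g)
      = bracket0 ω e m f g - c • bracketInf ω e m f g := by
  rw [PsiDO.H0_add_central (const_mul_comm c) (PsiDO.plus_const_mul _), sub_mul, map_sub,
    mul_assoc, trace_const_mul]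
  rfl

theorem bracket_pencil (α β : ℝ) (f g : Functional m n) :
    bracket ω e (pencil e m α β) f g = α • bracket0 ω e m f g + β • bracketInf ω e m f g := by
  rw [bracket_eq_trace, pencil, add_mul, map_add, mul_assoc, mul_assoc]
  exact congrArg₂ (· + ·) (trace_const_mul ω α _) (trace_const_mul ω β _)

theorem shifted_skew (c : ℝ) (f g : Functional m n) :
    bracket0 ω e m f g - c • bracketInf ω e m f g
      = -(bracket0 ω e m g f - c • bracketInf ω e m g f) := by
  rw [← trace_H0_shift, ← trace_H0_shift]
  exact (isotropicSplitting_trace ω).adler_skew _ _ _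

theorem shifted_jacobi (c : ℝ) (f g h : Functional m n) :
    let b := bracket0 ω e m - c • bracketInf ω e m
    b f (b g h) + b g (b h f) + b h (b f g) = 0 := by
  intro b
  have hb : ∀ f g, b f g
      = trace ω (PsiDO.H0 (genericL e m + const A c) (grad ω e f) * grad ω e g) :=
    fun f g => (trace_H0_shift ω e c f g).symm
  have hL : (genericL e m + const A c).OrdLE m := (ordLE_genericL e m).add
    ((PsiDO.ordLE_monomial _ 0).mono (by omega))
  simp only [hb]
  refine (isotropicSplitting_trace ω).adler_jacobi (l := genericL e m + const A c)
    (X := grad ω e)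
    (D := fun f => flow ω e (PsiDO.H0 (genericL e m + const A c) (grad ω e f)))
    (ev := fun f => (evoF (char ω e (PsiDO.H0 (genericL e m + const A c)
      (grad ω e f)))).toAddMonoidHom) ?_ ?_ ?_ ?_ ?_ ?_ f g h
  · exact fun f => flow_mul ω e _
  · exact fun f => flow_plus ω e _
  · intro f
    -- The flow kills the constant `c`, so `ℒ` and `ℒ + c` have the same velocity.
    rw [map_add, flow_genericL ω e (PsiDO.ordLE_H0 hL _), const, flow_const, add_zero]
    rfl
  · exact fun f => trace_flow ω e _
  · exact fun f g => (trace_mul_grad ω e _ g).symm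
  · exact fun f g h => trace_second_variation ω e _ _ h

theorem isHamiltonian_pencil (m : ℕ) (α β : ℝ) : IsHamiltonian ω e (pencil e m α β) where
  vectorField f i hi := by
    rw [pencil, PsiDO.coeff_add, PsiDO.coeff_const_mul, PsiDO.coeff_const_mul,
      PsiDO.ordLE_H0 (ordLE_genericL e m) _ i (by omega),
      PsiDO.ordLE_Hinf (ordLE_genericL e m) (by omega) _ i (by omega)]
    simp
  add_left f₁ f₂ g := by
    simp only [bracket_pencil, map_add, LinearMap.add_apply, smul_add]
    abel
  smul_left c f g := by
    simp only [bracket_pencil, map_smul, LinearMap.smul_apply, smul_add, smul_comm c]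
  skew f g := by
    have h0 := shifted_skew ω e 0 f g
    have h1 := shifted_skew ω e 1 f g
    simp only [bracket_pencil]
    -- The pencil bracket equals `α + β` times the bracket at `c = 0` minus `β` times that at `c =
    -- 1`.
    linear_combination (norm := module) (α + β) • h0 - β • h1
  jacobi f g h := by
    have h0 := shifted_jacobi ω e (m := m) 0 f g h
    have h1 := shifted_jacobi ω e (m := m) 1 f g h
    have h2 := shifted_jacobi ω e (m := m) (-1) f g h
    simp only [bracket_pencil, LinearMap.sub_apply, LinearMap.smul_apply, map_sub, map_add,
      map_smul] at h0 h1 h2 ⊢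
    -- At shift `c` the Jacobi sum is `J₀₀ - c J₀₁ + c² J₁₁`. Its values at `0, 1, -1` are combined
    -- here into `α² J₀₀ + αβ J₀₁ + β² J₁₁`.
    linear_combination (norm := module) (α ^ 2 - β ^ 2) • h0 + ((β ^ 2 - α * β) / 2) • h1
      + ((β ^ 2 + α * β) / 2) • h2

end Hamiltonian

/-! ### Negligible tails, naturality and equations of Lax form -/

namespace PsiDO

variable {k : Type u} [CommRing k] {R : Type v} [CommRing R] [Algebra k R]
variable {d : Derivation k R R}
variable {k' : Type u} [CommRing k'] {R' : Type w} [CommRing R'] [Algebra k' R']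
variable {d' : Derivation k' R' R'}

/-- This tail is exactly what `ordLE_of_trace_eq_zero` leaves undetermined in a gradient. -/
theorem H0_eq_zero {L P : PsiDO d} {N : ℤ} (hL : L.OrdLE N) (hP : P.OrdLE (-N - 1)) :
    H0 L P = 0 := by
  rw [H0, plus_eq_zero ((hL.mul hP).mono (by omega)), plus_eq_zero ((hP.mul hL).mono (by omega)),
    zero_mul, mul_zero, sub_zero]

theorem Hinf_eq_zero {L P : PsiDO d} {N : ℤ} (hN : 0 ≤ N) (hL : L.OrdLE N)
    (hP : P.OrdLE (-N - 1)) : Hinf L P = 0 := by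
  rw [Hinf_eq, H0_eq_zero hL hP, H0_eq_zero (hL.add (isMonic_one.ordLE.mono hN)) hP, sub_zero]

section MapRingHom

variable {φ : R →+* R'} {hφ : ∀ a, φ (d a) = d' (φ a)}

theorem mapRingHom_plus (P : PsiDO d) :
    mapRingHom (d' := d') φ hφ P.plus = (mapRingHom (d' := d') φ hφ P).plus := mapCoeff_plus _ P

theorem mapRingHom_comm (P Q : PsiDO d) : mapRingHom (d' := d') φ hφ (comm P Q)
    = comm (mapRingHom (d' := d') φ hφ P) (mapRingHom (d' := d') φ hφ Q) := by
  simp only [comm, map_sub, map_mul]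

theorem mapRingHom_H0 (P Q : PsiDO d) : mapRingHom (d' := d') φ hφ (H0 P Q)
    = H0 (mapRingHom (d' := d') φ hφ P) (mapRingHom (d' := d') φ hφ Q) := by
  simp only [H0, map_sub, map_mul, mapRingHom_plus]

theorem mapRingHom_Hinf (P Q : PsiDO d) : mapRingHom (d' := d') φ hφ (Hinf P Q)
    = Hinf (mapRingHom (d' := d') φ hφ P) (mapRingHom (d' := d') φ hφ Q) := by
  simp only [Hinf_eq, map_sub, map_add, map_one, mapRingHom_H0]

theorem IsMonic.mapRingHom {P : PsiDO d} {N : ℤ} (hP : P.IsMonic N) :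
    (mapRingHom (d' := d') φ hφ P).IsMonic N :=
  ⟨(congrArg φ hP.1).trans (map_one φ), fun i hi => (congrArg φ (hP.2 i hi)).trans (map_zero φ)⟩

end MapRingHom

/-- An equation of Lax form for a monic first-order operator is equivalent to the equation of
the same form for a power of the operator. -/
theorem isKPFlow_iff {A : Type u} [CommRing A] {R : Type v} [CommRing R] [Algebra A R]
    {d D : Derivation A R R} (hD : ∀ a, D (d a) = d (D a)) {M : PsiDO d} (hM : M.IsMonic 1)
    {n : ℕ} {c : R} (hc : c * n = 1) (r : ℕ) :
    IsKPFlow D M r ↔ timeDeriv D (M ^ n) = comm (M ^ r).plus (M ^ n) := by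
  -- `δ = ∂_t - [B_r, ·]` satisfies the Leibniz rule, so it vanishes on `M` if and only if it
  -- vanishes on `M ^ n`.
  let δ : PsiDO d →+ PsiDO d := timeDerivHom D
    - (mulHom d (M ^ r).plus - (mulHom d).flip (M ^ r).plus)
  have hδ : ∀ P, δ P = timeDeriv D P - comm (M ^ r).plus P := fun P => rfl
  have hl : ∀ P Q, δ (P * Q) = δ P * Q + P * δ Q := fun P Q => by
    simp only [hδ, timeDeriv_mul hD, comm, sub_mul, mul_sub, mul_assoc]
    abel
  rw [IsKPFlow, ← sub_eq_zero, ← sub_eq_zero (a := timeDeriv D (M ^ n)), ← hδ, ← hδ]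
  exact ⟨fun h => leibniz_pow_eq_zero δ hl h n, eq_zero_of_leibniz_pow hc hM δ hl⟩

end PsiDO

/-! ### Functionals of the form `∫ tr F(V) dx` -/

section TraceFunctionals

variable {A : Type u} [CommRing A] [Algebra ℝ A] {n m : ℕ}
variable (ω : TraceForm A) (e : Module.Basis (Fin n) ℝ A)

/-- The `A`-valued differential polynomials in the fields `V_i`. -/
def jetRing (m : ℕ) : Subring (DiffPoly m n A) :=
  (Algebra.adjoin A
    (Set.range fun p : Set.Iio (m : ℤ) × ℕ => (jetV e p.1 p.2 : DiffPoly m n A))).toSubring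

theorem jetRing_induction {P : DiffPoly m n A → Prop} (hjet : ∀ i j, P (jetV e i j))
    (hC : ∀ a, P (C a)) (hadd : ∀ F ∈ jetRing e m, ∀ G ∈ jetRing e m, P F → P G → P (F + G))
    (hmul : ∀ F ∈ jetRing e m, ∀ G ∈ jetRing e m, P F → P G → P (F * G)) {F : DiffPoly m n A}
    (hF : F ∈ jetRing e m) : P F := by
  refine Algebra.adjoin_induction (p := fun F _ => P F) ?_ hC (fun F G hF hG => hadd F hF G hG)
    (fun F G hF hG => hmul F hF G hG) (show F ∈ Algebra.adjoin A _ from hF)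
  rintro _ ⟨p, rfl⟩
  exact hjet _ _

theorem jetV_mem (i : Set.Iio (m : ℤ)) (j : ℕ) : (jetV e i j : DiffPoly m n A) ∈ jetRing e m :=
  Algebra.subset_adjoin ⟨(i, j), rfl⟩

theorem C_mem_jetRing (a : A) : (C a : DiffPoly m n A) ∈ jetRing e m :=
  Subalgebra.algebraMap_mem (Algebra.adjoin A _) a

theorem totalD_mem_jetRing {F : DiffPoly m n A} (hF : F ∈ jetRing e m) :
    totalD m n A F ∈ jetRing e m := by
  refine jetRing_induction e (P := fun F => totalD m n A F ∈ jetRing e m) ?_ ?_ ?_ ?_ hF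
  · intro i j
    have : totalD m n A (jetV e i j) = jetV e i (j + 1) := by
      simp only [jetV, map_sum, derivation_const_mul, totalD, mkDerivation_X]
    rw [this]
    exact jetV_mem e i (j + 1)
  · intro a; rw [totalD_C]; exact zero_mem _
  · intro F hF G hG h h'; rw [map_add]; exact add_mem h h'
  · intro F hF G hG h h'
    rw [Derivation.leibniz]
    exact add_mem (mul_mem hF h') (mul_mem hG h)

/-- Chain rule: `v_{[i]q}^{(j)}` enters `F` only through `V_i^{(j)}`, with coefficient `e_q`. The
witness `G` plays the role of `∂F/∂V_i^{(j)}` and is independent of `q`. -/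
theorem pderiv_of_mem_jetRing {F : DiffPoly m n A} (hF : F ∈ jetRing e m) (i : Set.Iio (m : ℤ))
    (j : ℕ) : ∃ G ∈ jetRing e m, ∀ q, pderiv (i, q, j) F = C (e q) * G := by
  refine jetRing_induction e
    (P := fun F => ∃ G ∈ jetRing e m, ∀ q, pderiv (i, q, j) F = C (e q) * G) ?_ ?_ ?_ ?_ hF
  · intro i' j'
    by_cases h : i = i' ∧ j = j'
    · obtain ⟨rfl, rfl⟩ := h
      refine ⟨1, one_mem _, fun q => ?_⟩
      rw [jetV, map_sum, Finset.sum_eq_single q]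
      · rw [derivation_const_mul, pderiv_X_self]
      · intro q' _ hq'
        rw [derivation_const_mul, pderiv_X_of_ne (by simpa using hq'), mul_zero]
      · simp
    · refine ⟨0, zero_mem _, fun q => ?_⟩
      rw [jetV, map_sum, Finset.sum_eq_zero, mul_zero]
      intro q' _
      rw [derivation_const_mul, pderiv_X_of_ne (fun h' => h ?_), mul_zero]
      simp only [Prod.mk.injEq] at h'
      exact ⟨h'.1.symm, h'.2.2.symm⟩
  · exact fun a => ⟨0, zero_mem _, fun q => by rw [derivation_C, mul_zero]⟩
  · rintro F hF G hG ⟨F', h1, h2⟩ ⟨G', h3, h4⟩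
    exact ⟨F' + G', add_mem h1 h3, fun q => by rw [map_add, h2, h4, mul_add]⟩
  · rintro F hF G hG ⟨F', h1, h2⟩ ⟨G', h3, h4⟩
    refine ⟨F * G' + G * F', add_mem (mul_mem hF h3) (mul_mem hG h1), fun q => ?_⟩
    rw [Derivation.leibniz, h2, h4, smul_eq_mul, smul_eq_mul]
    ring

theorem trPoly_pderiv (p : JetVar m n) (F : DiffPoly m n A) :
    trPoly ω (pderiv p F) = pderiv p (trPoly ω F) := by
  classical
  have hR : (pderiv p : Derivation ℝ (DiffPoly m n ℝ) _) = mkDerivation ℝ (Pi.single p 1) :=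
    derivation_ext fun p' => by rw [pderiv_X, mkDerivation_X]
  have hA : (pderiv p : Derivation A (DiffPoly m n A) _)
      = mkDerivation A (fun p' => baseExt A (Pi.single (M := fun _ => DiffPoly m n ℝ) p 1 p')) :=
    derivation_ext fun p' => by
      rw [pderiv_X, mkDerivation_X]
      simp only [Pi.single_apply, apply_ite (baseExt A), map_one, map_zero]
  rw [hR, hA, trPoly_mkDerivation]

/-- The partial derivatives factor as `e_q` times `∂F/∂V_i^{(j)}`, so expansion in the dual basis
collapses the gradient to `∑_j (-∂)^j ∂F/∂V_i^{(j)}`. -/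
theorem gradV_mem_jetRing {f : Functional m n} (hf : f ∈ trFunctionals ω e m)
    (i : Set.Iio (m : ℤ)) : gradV ω e f i ∈ jetRing e m := by
  obtain ⟨F, hF, rfl⟩ := hf
  obtain ⟨I, J, hI⟩ := exists_box (trPoly ω F)
  choose G hG hG' using pderiv_of_mem_jetRing e (show F ∈ jetRing e m from hF) i
  have hit : ∀ (j : ℕ) (G : DiffPoly m n A), G ∈ jetRing e m →
      (totalD m n A)^[j] G ∈ jetRing e m := by
    intro j
    induction j with
    | zero => exact fun G hG => hG
    | succ j ih => exact fun G hG => ih _ (totalD_mem_jetRing e hG)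
  have hneg : ∀ (j : ℕ) (G : DiffPoly m n A), negDPow m n j (trPoly ω G)
      = trPoly ω ((-1) ^ j * (totalD m n A)^[j] G) := by
    intro j G
    have h1 : (totalD m n ℝ)^[j] (trPoly ω G) = trPoly ω ((totalD m n A)^[j] G) :=
      (Function.Semiconj.iterate_right (f := trPoly ω) (trPoly_totalD ω) j G).symm
    have h2 : ((-1 : DiffPoly m n A)) ^ j = baseExt A ((-1) ^ j) := by simp
    rw [negDPow_apply, h1, h2, mul_comm (baseExt A _), trPoly_mul_ext, mul_comm]
  have hW : ∀ q, varDeriv i q (integral (trPoly ω F)) = trPoly ω (C (e q)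
      * ∑ j ∈ Finset.range J, (-1) ^ j * (totalD m n A)^[j] (G j)) := by
    intro q
    rw [varDeriv_integral, euler_eq_sum hI, Finset.mul_sum, trPoly_sum]
    refine Finset.sum_congr rfl fun j _ => ?_
    rw [← trPoly_pderiv, hG', hneg]
    congr 1
    have h3 : (totalD m n A)^[j] (C (e q) * G j) = C (e q) * (totalD m n A)^[j] (G j) :=
      Function.Semiconj.iterate_right (f := fun x => C (e q) * x)
        (fun x => (derivation_const_mul _ _ x).symm) j (G j) |>.symm
    rw [h3]
    ring
  have h4 : gradV ω e (integral (trPoly ω F)) i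
      = ∑ j ∈ Finset.range J, (-1) ^ j * (totalD m n A)^[j] (G j) := by
    rw [gradV]
    simp only [hW]
    exact (diffPoly_expansion (ω.dual_expansion e) _).symm
  rw [h4]
  exact sum_mem fun j _ => mul_mem (pow_mem (neg_mem (one_mem _)) _) (hit _ _ (hG j))

theorem coeffsIn_grad {f : Functional m n} (hf : f ∈ trFunctionals ω e m) :
    (grad ω e f).CoeffsIn (jetRing e m) :=
  finsum_induction (fun P : PsiDO (totalD m n A) => P.CoeffsIn (jetRing e m))
    (fun _ => zero_mem _) (fun _ _ h h' => h.add h') fun i =>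
      (PsiDO.coeffsIn_monomial (one_mem _) _).mul (fun _ => totalD_mem_jetRing e)
        (PsiDO.coeffsIn_monomial (gradV_mem_jetRing ω e hf i) 0)

theorem coeffsIn_genericL : (genericL e m).CoeffsIn (jetRing e m) := fun i => by
  change (if h : i < (m : ℤ) then jetV e ⟨i, h⟩ 0 else if i = m then 1 else 0) ∈ _
  split_ifs
  exacts [jetV_mem e _ _, one_mem _, zero_mem _]

theorem trace_mem_trFunctionals {P : PsiDO (totalD m n A)} (hP : P.CoeffsIn (jetRing e m)) :
    trace ω P ∈ trFunctionals ω e m := ⟨P.res, hP (-1), rfl⟩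

theorem smul_trace_mem_trFunctionals (c : ℝ) {P : PsiDO (totalD m n A)}
    (hP : P.CoeffsIn (jetRing e m)) : c • trace ω P ∈ trFunctionals ω e m := by
  rw [← trace_const_mul]
  exact trace_mem_trFunctionals ω e ((PsiDO.coeffsIn_monomial (C_mem_jetRing e _) 0).mul
    (fun _ => totalD_mem_jetRing e) hP)

theorem bracket_mem_trFunctionals {H : PsiDO (totalD m n A) → PsiDO (totalD m n A)}
    (hH : ∀ P, P.CoeffsIn (jetRing e m) → (H P).CoeffsIn (jetRing e m)) {f g : Functional m n}
    (hf : f ∈ trFunctionals ω e m) (hg : g ∈ trFunctionals ω e m) :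
    bracket ω e H f g ∈ trFunctionals ω e m :=
  trace_mem_trFunctionals ω e ((hH _ (coeffsIn_grad ω e hf)).mul (fun _ => totalD_mem_jetRing e)
    (coeffsIn_grad ω e hg))

end TraceFunctionals

/-! ### Evaluation at concrete fields -/

section Evaluation

variable {A : Type u} [CommRing A] {n m : ℕ}
variable {R : Type v} [CommRing R] [Algebra A R] (d : Derivation A R R)
  (w : Set.Iio (m : ℤ) → Fin n → R)

theorem subst_X (p : JetVar m n) :
    subst d w (X p : DiffPoly m n A) = d^[p.2.2] (w p.1 p.2.1) := aeval_X _ _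

theorem subst_C (a : A) : subst d w (C a : DiffPoly m n A) = algebraMap A R a := aeval_C _ _

theorem subst_totalD (F : DiffPoly m n A) : subst d w (totalD m n A F) = d (subst d w F) := by
  induction F using MvPolynomial.induction_on with
  | C a => rw [totalD_C, subst_C, map_zero, Derivation.map_algebraMap]
  | add F G hF hG => simp only [map_add, hF, hG]
  | mul_X F p hF =>
    rw [Derivation.leibniz, map_mul, Derivation.leibniz, map_add, smul_eq_mul, smul_eq_mul,
      map_mul, map_mul, hF, totalD, mkDerivation_X, subst_X, subst_X, Function.iterate_succ_apply']
    rfl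

/-- Evaluation of operators at fields, as a ring homomorphism. -/
def evalHom : PsiDO (totalD m n A) →+* PsiDO d :=
  PsiDO.mapRingHom (subst d w) (subst_totalD d w)

end Evaluation

/-! ### Gradients of the Hamiltonians and the hierarchy -/

section Hierarchy

variable {A : Type u} [CommRing A] [Algebra ℝ A] {n m : ℕ}

theorem isMonic_genericL (e : Module.Basis (Fin n) ℝ A) (m : ℕ) : (genericL e m).IsMonic m :=
  ⟨by
    change (if h : (m : ℤ) < (m : ℤ) then jetV e ⟨m, h⟩ 0 else if (m : ℤ) = m then 1 else 0) = _
    rw [dif_neg (lt_irrefl _), if_pos rfl], ordLE_genericL e m⟩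

theorem inv_mul_natCast (hm : 1 ≤ m) {R : Type v} [CommRing R] [Algebra A R] :
    algebraMap A R (algebraMap ℝ A (m : ℝ)⁻¹) * (m : R) = 1 := by
  have h : ((m : ℝ))⁻¹ * m = 1 := inv_mul_cancel₀ (by positivity)
  have h1 := congrArg (fun x => algebraMap A R (algebraMap ℝ A x)) h
  simpa only [map_mul, map_natCast, map_one] using h1

variable (ω : TraceForm A) (e : Module.Basis (Fin n) ℝ A)

/-- Cyclicity lets the factors commuting with `Q` be collected as for commuting variables. The shape
`Q * L` avoids the exponent `k - 1` and, with `Q` containing an inverse of `L`, also covers negative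
powers. -/
theorem trace_mul_flow_pow {Y L Q : PsiDO (totalD m n A)} (hQ : Commute Q L) (k : ℕ) :
    trace ω (Q * L * flow ω e Y (L ^ k)) = (k : ℝ) • trace ω (Q * L ^ k * flow ω e Y L) := by
  induction k generalizing Q with
  | zero =>
    have h1 : flow ω e Y 1 = 0 := by simpa using flow_mul ω e Y 1 1
    rw [pow_zero, h1]
    simp
  | succ k ih =>
    have h2 : trace ω (Q * L * (flow ω e Y (L ^ k) * L))
        = trace ω (Q * L * L * flow ω e Y (L ^ k)) := by
      rw [← mul_assoc, (isotropicSplitting_trace ω).trace_comm, ← mul_assoc L, ← mul_assoc L,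
        ← hQ.eq]
    have h3 : Q * L * L ^ k = Q * L ^ (k + 1) := by rw [mul_assoc, ← pow_succ']
    rw [pow_succ, flow_mul, mul_add, map_add, h2, ih (hQ.mul_left (Commute.refl L)), ← mul_assoc,
      h3, pow_succ]
    push_cast
    module

/-- The gradients of the functionals `tr ∫ res L^k dx`. -/
theorem ordLE_grad_trace_pow {L J : PsiDO (totalD m n A)} (hL : L ^ m = genericL e m)
    (h1 : L * J = 1) (h2 : J * L = 1) {k : ℕ} (hk : 1 ≤ k) :
    (grad ω e (((m : ℝ) / k) • trace ω (L ^ k)) - L ^ k * J ^ m).OrdLE (-m - 1) := by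
  have hJL : Commute J L := h2.trans h1.symm
  refine ordLE_of_trace_eq_zero ω e fun Y hY => ?_
  have e1 : trace ω (flow ω e Y (L ^ k)) = (k : ℝ) • trace ω (J * L ^ k * flow ω e Y L) := by
    rw [← trace_mul_flow_pow ω e hJL, h2, one_mul]
  -- Here `J` is the inverse of `L`, so `L ^ k * J ^ m` is `L^{k-m}`. Since `Y` is the variation of
  -- `L ^ m`, pairing it with `L^{k-m}` gives `m` times the pairing of `L^{k-1}` with the variation
  -- of `L`.
  have e2 : trace ω (Y * (L ^ k * J ^ m)) = (m : ℝ) • trace ω (J * L ^ k * flow ω e Y L) := by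
    have h3 : flow ω e Y (L ^ m) = Y := by rw [hL]; exact flow_genericL ω e hY
    have hQ : Commute (L ^ k * J ^ m * J) L :=
      (((Commute.refl L).pow_left k).mul_left (hJL.pow_left m)).mul_left hJL
    have h4 := trace_mul_flow_pow ω e (Y := Y) hQ m
    have h5 : L ^ k * J ^ m * J * L = L ^ k * J ^ m := by rw [mul_assoc _ J, h2, mul_one]
    have h6 : L ^ k * J ^ m * J * L ^ m = J * L ^ k := by
      rw [mul_assoc, (hJL.pow_right m).eq, ← mul_assoc, mul_assoc (L ^ k),
        ← hJL.mul_pow, h2, one_pow, mul_one,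
        (hJL.pow_right k).eq]
    rw [h5, h6, h3] at h4
    rw [(isotropicSplitting_trace ω).trace_comm, h4]
  have hk' : (k : ℝ) ≠ 0 := by positivity
  rw [mul_sub, map_sub, trace_mul_grad, map_smul, ← trace_flow, e1, e2, smul_smul,
    div_mul_cancel₀ _ hk', sub_self]

/-- Up to a tail that `H0` kills, the gradient is `L^{r-m}`. Its product with `L ^ m` on either side
is `L ^ r`. -/
theorem H0_grad_hamH {L : PsiDO (totalD m n A)} (hL1 : L.IsMonic 1)
    (hL : L ^ m = genericL e m) {r : ℕ} (hr : 1 ≤ r) :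
    PsiDO.H0 (L ^ m) (grad ω e (hamH ω L r)) = PsiDO.comm (L ^ r).plus (L ^ m) := by
  obtain ⟨J, h1, h2⟩ := PsiDO.exists_inv hL1
  have hJL : Commute J L := h2.trans h1.symm
  have h3 := PsiDO.H0_eq_zero (hL1.pow m).ordLE (ordLE_grad_trace_pow ω e hL h1 h2 hr)
  rw [PsiDO.H0_sub, sub_eq_zero] at h3
  have h4 : L ^ r * J ^ m * L ^ m = L ^ r := by
    rw [mul_assoc, ← hJL.mul_pow, h2, one_pow, mul_one]
  have h5 : L ^ m * (L ^ r * J ^ m) = L ^ r := by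
    rw [← mul_assoc, ← pow_add, add_comm, pow_add, mul_assoc, ← hJL.symm.mul_pow, h1, one_pow,
      mul_one]
  refine h3.trans ?_
  rw [PsiDO.H0, h4, h5, PsiDO.comm]

theorem hamG_eq (L : PsiDO (totalD m n A)) (r : ℕ) :
    hamG ω L r = (-1 : ℝ) • hamH ω L (m + r) := by
  rw [hamG, hamH, smul_smul]
  push_cast
  rw [neg_one_mul, add_comm (r : ℝ)]

/-- Up to a tail that `Hinf` kills, the gradient is `-L ^ r`. It commutes with `L ^ m`, so only the
term `-[L ^ m, (L ^ r)_+]` of `Hinf_eq_comm` survives. -/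
theorem Hinf_grad_hamG (hm : 1 ≤ m) {L : PsiDO (totalD m n A)} (hL1 : L.IsMonic 1)
    (hL : L ^ m = genericL e m) {r : ℕ} (hr : 1 ≤ r) :
    PsiDO.Hinf (L ^ m) (grad ω e (hamG ω L r)) = PsiDO.comm (L ^ r).plus (L ^ m) := by
  obtain ⟨J, h1, h2⟩ := PsiDO.exists_inv hL1
  have hJL : Commute J L := h2.trans h1.symm
  have h3 := PsiDO.Hinf_eq_zero (by omega) (hL1.pow m).ordLE
    (ordLE_grad_trace_pow ω e hL h1 h2 (k := m + r) (by omega))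
  rw [PsiDO.Hinf_sub, sub_eq_zero] at h3
  have h4 : L ^ (m + r) * J ^ m = L ^ r := by
    rw [add_comm, pow_add, mul_assoc, ← hJL.symm.mul_pow, h1, one_pow, mul_one]
  rw [h4] at h3
  have h5 : PsiDO.comm (L ^ m) (L ^ r) = 0 := sub_eq_zero.2 (Commute.pow_pow (Commute.refl L) m r)
  have h6 : PsiDO.plus (0 : PsiDO (totalD m n A)) = 0 := map_zero (PsiDO.plusHom _)
  rw [hamG_eq, grad_smul, const, PsiDO.Hinf_const_mul (totalD_C _)]
  refine (congrArg _ h3).trans ?_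
  rw [PsiDO.Hinf_eq_comm, h5, h6, sub_zero]
  have h7 : ∀ P : PsiDO (totalD m n A), PsiDO.monomial (C (algebraMap ℝ A (-1))) 0 * P = -P :=
    fun P => PsiDO.ext fun i => by rw [PsiDO.coeff_const_mul]; simp
  rw [h7, PsiDO.comm, PsiDO.comm, neg_sub]

variable {R : Type v} [CommRing R] [Algebra A R] {d : Derivation A R R}
  {w : Set.Iio (m : ℤ) → Fin n → R}

theorem evalHom_genericL {M : PsiDO d} (hM : M.IsMonic 1)
    (hw : ∀ i : Set.Iio (m : ℤ), (M ^ m).coeff i = ∑ q, e q • w i q) :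
    evalHom d w (genericL e m) = M ^ m := by
  ext1 i
  change subst d w (if h : i < (m : ℤ) then jetV e ⟨i, h⟩ 0 else if i = m then 1 else 0) = _
  split_ifs with h1 h2
  · rw [hw ⟨i, h1⟩, jetV, map_sum]
    exact Finset.sum_congr rfl fun q _ => by
      rw [map_mul, subst_C, subst_X, Algebra.smul_def]; rfl
  · rw [map_one, h2, (hM.pow m).1]
  · rw [map_zero, (hM.pow m).2 i (by omega)]

theorem evalHom_root (hm : 1 ≤ m) {L : PsiDO (totalD m n A)} (hL1 : L.IsMonic 1)
    (hL : L ^ m = genericL e m) {M : PsiDO d} (hM : M.IsMonic 1)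
    (hw : ∀ i : Set.Iio (m : ℤ), (M ^ m).coeff i = ∑ q, e q • w i q) : evalHom d w L = M :=
  PsiDO.pow_injective (inv_mul_natCast (A := A) hm) hM hL1.mapRingHom (by
    have := evalHom_genericL e hM hw
    rw [← hL, map_pow] at this
    exact this)

end Hierarchy

end AKP

end

/-! ### The main theorem -/

theorem theorem3p4 {A : Type*} [CommRing A] [Algebra ℝ A] {n : ℕ}
    (e : Module.Basis (Fin n) ℝ A) (ω : AKP.TraceForm A) (m : ℕ) (hm : 1 ≤ m) :
    -- the two operators are Hamiltonian and compatible
    (∀ α β : ℝ, AKP.IsHamiltonian ω e (AKP.pencil e m α β)) ∧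
    (∀ f ∈ AKP.trFunctionals ω e m, ∀ g ∈ AKP.trFunctionals ω e m,
      AKP.bracket ω e (AKP.PsiDO.H0 (AKP.genericL e m)) f g ∈ AKP.trFunctionals ω e m ∧
      AKP.bracket ω e (AKP.PsiDO.Hinf (AKP.genericL e m)) f g ∈ AKP.trFunctionals ω e m) ∧
    -- `L` is the monic first-order root of the universal operator `ℒ = L ^ m`
    ∃ L : AKP.PsiDO (AKP.totalD m n A),
      (L.IsMonic 1 ∧ L ^ m = AKP.genericL e m) ∧
      (∀ K : AKP.PsiDO (AKP.totalD m n A),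
        K.IsMonic 1 → K ^ m = AKP.genericL e m → K = L) ∧
      ∀ r : ℕ, 1 ≤ r →
        AKP.hamH ω L r ∈ AKP.trFunctionals ω e m ∧
        AKP.hamG ω L r ∈ AKP.trFunctionals ω e m ∧
        AKP.PsiDO.H0 (L ^ m) (AKP.grad ω e (AKP.hamH ω L r))
          = AKP.PsiDO.comm (L ^ r).plus (L ^ m) ∧
        AKP.PsiDO.Hinf (L ^ m) (AKP.grad ω e (AKP.hamG ω L r))
          = AKP.PsiDO.comm (L ^ r).plus (L ^ m) ∧
        -- the equations of motion, for fields in any commutative `A`-algebra `R` with commuting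
        -- `A`-linear derivations `d = ∂/∂x` and `D = ∂/∂t_r`, such as smooth `A`-valued functions
        ∀ (R : Type*) [CommRing R] [Algebra A R] (d D : Derivation A R R),
          (∀ a, D (d a) = d (D a)) →
          ∀ (M : AKP.PsiDO d), M.IsMonic 1 →
          ∀ w : Set.Iio (m : ℤ) → Fin n → R,
            (∀ i : Set.Iio (m : ℤ), (M ^ m).coeff i = ∑ q, e q • w i q) →
            (AKP.IsKPFlow D M r ↔ AKP.timeDeriv D (M ^ m)
              = AKP.PsiDO.H0 (M ^ m) (AKP.evalOp d w (AKP.grad ω e (AKP.hamH ω L r)))) ∧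
            (AKP.IsKPFlow D M r ↔ AKP.timeDeriv D (M ^ m)
              = AKP.PsiDO.Hinf (M ^ m) (AKP.evalOp d w (AKP.grad ω e (AKP.hamG ω L r)))) := by
  obtain ⟨L, hLB, hL1, hL⟩ := AKP.PsiDO.exists_root (fun _ => AKP.totalD_mem_jetRing e)
    (AKP.inv_mul_natCast (A := A) hm) (AKP.C_mem_jetRing e _) (AKP.isMonic_genericL e m)
    (AKP.coeffsIn_genericL e)
  have hLr := fun r => hLB.pow (fun _ => AKP.totalD_mem_jetRing e) r
  refine ⟨AKP.isHamiltonian_pencil ω e m, fun f hf g hg => ⟨?_, ?_⟩, L, ⟨hL1, hL⟩, ?_, ?_⟩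
  · exact AKP.bracket_mem_trFunctionals ω e (fun P hP => (AKP.coeffsIn_genericL e).H0
      (fun _ => AKP.totalD_mem_jetRing e) hP) hf hg
  · exact AKP.bracket_mem_trFunctionals ω e (fun P hP => (AKP.coeffsIn_genericL e).Hinf
      (fun _ => AKP.totalD_mem_jetRing e) hP) hf hg
  · intro K hK1 hK
    exact AKP.PsiDO.pow_injective (AKP.inv_mul_natCast (A := A) hm) hL1 hK1 (hK.trans hL.symm)
  intro r hr
  have hH := AKP.H0_grad_hamH ω e hL1 hL hr
  have hG := AKP.Hinf_grad_hamG ω e hm hL1 hL hr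
  refine ⟨AKP.smul_trace_mem_trFunctionals ω e _ (hLr r),
    AKP.smul_trace_mem_trFunctionals ω e _ (hLr (m + r)), hH, hG, ?_⟩
  intro R _ _ d D hD M hM w hw
  -- Any components `w` of the coefficients of `M ^ m` send `ℒ` to `M ^ m`. Uniqueness of monic
  -- roots then sends `L` to `M`, and the universal identities `hH` and `hG` specialise.
  have hφ : AKP.evalHom d w L = M := AKP.evalHom_root e hm hL1 hL hM hw
  have hkp := AKP.PsiDO.isKPFlow_iff hD hM (AKP.inv_mul_natCast (A := A) (R := R) hm) r
  have hc : AKP.evalHom d w (AKP.PsiDO.comm (L ^ r).plus (L ^ m))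
      = AKP.PsiDO.comm (M ^ r).plus (M ^ m) := by
    rw [← hφ, ← map_pow, ← map_pow]
    refine (AKP.PsiDO.mapRingHom_comm _ _).trans ?_
    rw [AKP.PsiDO.mapRingHom_plus]
    rfl
  have h0 := congrArg (AKP.evalHom d w) hH
  have h1 := congrArg (AKP.evalHom d w) hG
  rw [hc] at h0 h1
  have hm' : AKP.evalHom d w (L ^ m) = M ^ m := by rw [map_pow, hφ]
  rw [hkp]
  constructor
  · rw [← h0, ← hm']
    exact iff_of_eq (congrArg _ (AKP.PsiDO.mapRingHom_H0 _ _))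
  · rw [← h1, ← hm']
    exact iff_of_eq (congrArg _ (AKP.PsiDO.mapRingHom_Hinf _ _))
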